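/- Let $d\ge 1$ and let $\mathbb X^d$ be either the Euclidean space $\mathbb R^d$ or the $d$-dimensional hyperbolic space $\mathbb H^d$ of curvature $-1$ (for $d=1$, $\mathbb H^1$ is the hyperboloid model, isometric to the real line), with Riemannian distance $d(\cdot,\cdot)$ and Riemannian volume $\mathrm{vol}$. Let $B_t$ be the closed ball of radius $t$ around a fixed origin $p$ (with $p=0$ if $\mathbb X^d=\mathbb R^d$, and $p\in\mathbb H^d$ arbitrary if $\mathbb X^d=\mathbb H^d$), and let $\eta$ be a Poisson process on $\mathbb X^d$ with intensity measure $\mathrm{vol}$. In the nearest neighbour embracing graph on $\eta$, each point $x\in\eta$ is joined to its nearest neighbour in $\eta$, then to its second nearest neighbour, and so on, until $x$ lies in the (geodesic) convex hull of the points it has been joined to; the number of these points is the outdegree $\overline{\deg}(x,\eta)$ of $x$. For $k\in\mathbb N$ put \[ G_t^{(k)}:=\bigl|\{x\in\eta\cap B_t:\ \overline{\deg}(x,\eta)=k\}\bigr| . \] For $t\ge 2$ let $\rho(t):=\kappa_d t^d$ with $\kappa_d=\pi^{d/2}/\Gamma(1+d/2)$ if $\mathbb X^d=\mathbb R^d$,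 and $\rho(t):=\gamma\, e^{t(d-1)}$ if $\mathbb X^d=\mathbb H^d$, where $\gamma>0$ is any fixed constant that depends on $d$ only. Then for every $k\ge d+1$ there is a constant $c>0$, depending only on $k$ and the choice of $\mathbb X^d$ (through $\gamma$ and $d$ in the hyperbolic case), such that for all $t\ge 2$ the random variable $G_t^{(k)}$ is square-integrable and \[ \operatorname{Var} G_t^{(k)}\ \ge\ c\,\rho(t)\qquad\text{and}\qquad \operatorname{Var} G_t^{(k)}\ \ge\ c\,\mathrm{vol}(B_t). \] -/

import Mathlib

open MeasureTheory ProbabilityTheory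

noncomputable section

namespace NNE

/-! ### Hyperbolic space -/

/-- The `d`-dimensional hyperbolic space of curvature `-1` in the hyperboloid model: the vector `v`
stands for the point `(√(1 + ‖v‖²), v)` of the upper sheet
`{(x₀, v) : x₀ > 0, x₀² - ‖v‖² = 1}` in Minkowski space. This is a synonym of the Euclidean space
only as a set of coordinate vectors: it has its own distance and its own volume. -/
def HypSpace (d : ℕ) : Type := EuclideanSpace ℝ (Fin d)

namespace HypSpace

variable {d : ℕ}

/-- The spatial coordinates of a point of the hyperboloid. -/
def vec (x : HypSpace d) : EuclideanSpace ℝ (Fin d) := x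

/-- The time coordinate of a point of the hyperboloid. -/
def time (x : HypSpace d) : ℝ := Real.sqrt (1 + ‖x.vec‖ ^ 2)

/-- The hyperbolic distance: `cosh (dist x y)` is minus the Minkowski product of `x` and `y`. -/
instance : Dist (HypSpace d) where
  dist x y := Real.arcosh (x.time * y.time - inner ℝ x.vec y.vec)

/-- The Borel σ-algebra. -/
instance : MeasurableSpace (HypSpace d) :=
  inferInstanceAs (MeasurableSpace (EuclideanSpace ℝ (Fin d)))

/-- The hyperbolic volume, whose element in the coordinates `v` is `dv / √(1 + ‖v‖²)`. -/
instance : MeasureSpace (HypSpace d) where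
  volume := (volume : Measure (EuclideanSpace ℝ (Fin d))).withDensity
    fun v => ENNReal.ofReal (1 / Real.sqrt (1 + ‖v‖ ^ 2))

end HypSpace

/-! ### Balls and geodesic convexity -/

section Geometry

variable {X : Type*} [Dist X]

/-- The closed ball of radius `r` centred at `p`. -/
def cball (p : X) (r : ℝ) : Set X := {y | dist p y ≤ r}

/-- `C` is geodesically convex: with any two points it contains the geodesic segment joining them,
that is, all points `z` with `dist x z + dist z y = dist x y`. (In Euclidean and in hyperbolic
space these are exactly the points of the unique shortest geodesic from `x` to `y`.) -/
def GeodConvex (C : Set X) : Prop :=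
  ∀ x ∈ C, ∀ y ∈ C, ∀ z, dist x z + dist z y = dist x y → z ∈ C

/-- The (geodesic) convex hull of `S`: the smallest geodesically convex set containing `S`. -/
def convHull (S : Set X) : Set X := ⋂₀ {C | S ⊆ C ∧ GeodConvex C}

/-! ### The nearest neighbour embracing graph -/

/-- The set of outgoing neighbours of `x` in the nearest neighbour embracing graph on the
configuration `η`: the other points of `η` are joined to `x` in the order of their distance from
`x`, until `x` lies in the convex hull of the points joined so far. Thus `y` is joined to `x`
precisely when `x` is not in the convex hull of the points that come before `y`. (For a Poisson
process almost surely no two points of `η` have the same distance from a third one, so there are no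
ties.) -/
def outNeighbours (x : X) (η : Set X) : Set X :=
  {y | y ∈ η ∧ y ≠ x ∧ x ∉ convHull {z | z ∈ η ∧ z ≠ x ∧ dist x z < dist x y}}

/-- The outdegree of `x`. -/
def outdeg (x : X) (η : Set X) : ℕ∞ := (outNeighbours x η).encard

/-- The number of points of `η` in the closed ball of radius `t` around `p` that have
outdegree `k` (a finite number for each locally finite `η`). -/
def outdegCount (k : ℕ) (p : X) (t : ℝ) (η : Set X) : ℝ :=
  ({x | x ∈ η ∧ x ∈ cball p t ∧ outdeg x η = k}.ncard : ℝ)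

end Geometry

/-! ### Poisson processes -/

/-- The random point set `η` is a Poisson process with intensity measure `μ`: the numbers of points
in measurable sets are random variables, the number of points in a set of finite measure is
Poisson distributed with mean the measure of the set, and the numbers of points in disjoint
sets are independent. (For a diffuse σ-finite `μ` a Poisson process has almost surely no multiple
points, so that it is a random set.) -/
structure IsPoissonProcess {Ω X : Type*} [MeasurableSpace Ω] [MeasurableSpace X]
    (η : Ω → Set X) (P : Measure Ω) (μ : Measure X) : Prop where
  measurable_count : ∀ B : Set X, MeasurableSet B → Measurable fun ω => (η ω ∩ B).encard
  map_count : ∀ B : Set X, MeasurableSet B → μ B ≠ ⊤ →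
    P.map (fun ω => (η ω ∩ B).encard)
      = (poissonMeasure (μ B).toNNReal).map (fun n : ℕ => (n : ℕ∞))
  indep_count : ∀ (n : ℕ) (B : Fin n → Set X), (∀ i, MeasurableSet (B i)) →
    (∀ i j, i ≠ j → Disjoint (B i) (B j)) →
    iIndepFun (fun i ω => (η ω ∩ B i).encard) P

/-! ### The volume growth functions -/

/-- The growth function of Euclidean space: `κ_d r^d`, with `κ_d = π^(d/2) / Γ(1 + d/2)` the volume
of the unit ball. -/
def rhoEucl (d : ℕ) (r : ℝ) : ℝ :=
  Real.pi ^ ((d : ℝ) / 2) / Real.Gamma (1 + (d : ℝ) / 2) * r ^ d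

/-- The growth function of hyperbolic space: `γ e^{r(d-1)}` for `r ≥ 2`, and `0` for `r < 2`. -/
def rhoHyp (d : ℕ) (γ : ℝ) (r : ℝ) : ℝ :=
  if 2 ≤ r then γ * Real.exp (r * ((d : ℝ) - 1)) else 0

end NNE

end

/-!
The lower bound holds because the space contains a number of disjoint cells that is proportional to
the volume of the ball, and a change of the configuration inside a cell, independent of everything
outside, changes the number of points of outdegree `k` with a probability bounded from below.

The cell at the origin has a core, the unit ball, and a shield. The shield consists of clusters of
at least `k + 2` points near each point of a `1`-net of the sphere of radius `3`, and of no other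
points between the unit ball and these clusters. Each point outside the core then has more than `k`
points outside the core that are closer to it than the whole core (`shielded_of_clusters`), and
therefore a point that has outdegree `k` without the points in the core has outdegree `k` with them
(`outdeg_eq_of_shielded`). If the core contains the gadget, that is, one point near the origin and
`k` points near the `d + 1` vertices of a small simplex around it, arranged such that the farthest
of the `k` points is the only one near its vertex, then the central point has outdegree `k`
(`exists_outdeg_eq`). So, on the shield event, the gadget gives at least one more point of outdegree
`k` than the empty core, whatever the points outside the core are. Points outside the core may gain
the outdegree `k` as well, but none of them loses it, so that only this one-sided comparison is
needed.

The test function of the cell is the indicator function of the shield event times a combination of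
those of the gadget and of the empty core, weighted to be centred. It is bounded by `1`, and, the
points inside and outside of the core being independent, its correlation with the number of points
of outdegree `k` is at least a constant `q > 0` (`le_integral_outdegCount_mul_testFun`). Moving the
cell by isometries to `N` centres at pairwise distance more than `8` gives independent centred test
functions `h_i`. If `G` is the number of points of outdegree `k`, then
`0 ≤ E (G - E G - q ∑ h_i)² ≤ Var G - N q²` (`mul_card_le_variance`). Finally `N` is at least of the
order of the volume of the ball (`exists_cells`).

Both spaces enter only through the structure `GeodesicModel`: in the Klein model, as in Euclidean
space, geodesic convexity is convexity of vectors. Square-integrability follows from the comparison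
with the number of all points in the ball. It includes measurability
(`exists_measurable_outdegCount`), which is obtained from a measurable enumeration of the points.
-/

noncomputable section

namespace NNE

/-! ### The space of configurations -/

/-- Point configurations in `X`: sets of points, with the σ-algebra generated by the numbers of
points in measurable sets, instead of the product σ-algebra of `Set X = X → Prop`. -/
structure Config (X : Type*) where
  /-- The set of points of a configuration. -/
  points : Set X

namespace Config

variable {X Ω : Type*} [MeasurableSpace X]

instance : MeasurableSpace (Config X) :=
  ⨆ B : {B : Set X // MeasurableSet B},
    MeasurableSpace.comap (fun S : Config X => (S.points ∩ B.1).encard) ⊤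

lemma measurable_encard {B : Set X} (hB : MeasurableSet B) :
    Measurable (fun S : Config X => (S.points ∩ B).encard) := by
  intro T _
  have : MeasurableSpace.comap (fun S : Config X => (S.points ∩ B).encard) ⊤
      ≤ (inferInstance : MeasurableSpace (Config X)) :=
    le_iSup (fun B : {B : Set X // MeasurableSet B} =>
      MeasurableSpace.comap (fun S : Config X => (S.points ∩ B.1).encard) ⊤) ⟨B, hB⟩
  exact this _ ⟨T, trivial, rfl⟩

lemma comap_eq_iSup (f : Ω → Config X) :
    MeasurableSpace.comap f inferInstance
      = ⨆ B : {B : Set X // MeasurableSet B},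
        MeasurableSpace.comap (fun ω => ((f ω).points ∩ B.1).encard) ⊤ := by
  change MeasurableSpace.comap f (⨆ B : {B : Set X // MeasurableSet B},
    MeasurableSpace.comap (fun S : Config X => (S.points ∩ B.1).encard) ⊤) = _
  rw [MeasurableSpace.comap_iSup]
  simp only [MeasurableSpace.comap_comp]
  rfl

lemma measurable_of_encard [MeasurableSpace Ω] {f : Ω → Config X}
    (hf : ∀ B : Set X, MeasurableSet B → Measurable fun ω => ((f ω).points ∩ B).encard) :
    Measurable f := by
  rw [measurable_iff_comap_le, comap_eq_iSup]
  exact iSup_le fun B => measurable_iff_comap_le.1 (hf B.1 B.2)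

lemma measurable_inter {A : Set X} (hA : MeasurableSet A) :
    Measurable (fun S : Config X => Config.mk (S.points ∩ A)) := by
  refine measurable_of_encard fun B hB => ?_
  simpa only [Set.inter_assoc] using measurable_encard (hA.inter hB)

lemma measurable_image {Y : Type*} [MeasurableSpace Y] (e : X ≃ᵐ Y) :
    Measurable (fun S : Config X => Config.mk (e '' S.points)) := by
  refine measurable_of_encard fun B hB => ?_
  have h := measurable_encard (X := X) (e.measurable hB)
  convert h using 2 with S
  rw [← Set.image_inter_preimage, e.injective.encard_image]

end Config

/-! ### Poisson processes: independence and void probabilities -/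

section Poisson

variable {X Ω : Type*}

/-- The cell of the partition generated by the sets `B i` on which the membership pattern is `b`,
intersected with `A`. -/
def patternCell (A : Set X) {ι : Type*} (B : ι → Set X) (b : ι → Bool) : Set X :=
  A ∩ {x | ∀ i, x ∈ B i ↔ b i = true}

lemma disjoint_patternCell {A : Set X} {ι : Type*} {B : ι → Set X} {b c : ι → Bool}
    (hbc : b ≠ c) : Disjoint (patternCell A B b) (patternCell A B c) := by
  rw [Set.disjoint_left]
  rintro x ⟨-, hb⟩ ⟨-, hc⟩
  refine hbc (funext fun i => ?_)
  have := (hb i).symm.trans (hc i)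
  exact Bool.eq_iff_iff.2 this

lemma encard_inter_patternCell (S A : Set X) {ι : Type*} [Fintype ι] [DecidableEq ι]
    (B : ι → Set X) (i : ι) :
    (S ∩ A ∩ B i).encard =
      ∑ b : ι → Bool, if b i = true then (S ∩ patternCell A B b).encard else 0 := by
  classical
  have key : S ∩ A ∩ B i
      = ⋃ b : ι → Bool, if b i = true then S ∩ patternCell A B b else ∅ := by
    ext x
    simp only [Set.mem_iUnion]
    constructor
    · rintro ⟨⟨hS, hA⟩, hB⟩
      refine ⟨fun j => decide (x ∈ B j), ?_⟩
      simp [hB, hS, hA, patternCell]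
    · rintro ⟨b, hb⟩
      split_ifs at hb with h
      · exact ⟨⟨hb.1, hb.2.1⟩, (hb.2.2 i).2 h⟩
      · exact hb.elim
  rw [key, Set.encard_iUnion_of_finite, finsum_eq_sum_of_fintype]
  · refine Finset.sum_congr rfl fun b _ => ?_
    split_ifs <;> simp
  · intro b c hbc
    simp only [Function.onFun]
    split_ifs
    · exact ((disjoint_patternCell hbc).mono Set.inter_subset_right Set.inter_subset_right)
    all_goals simp

variable [MeasurableSpace X] [MeasurableSpace Ω] {η : Ω → Set X} {P : Measure Ω}
  {μ : Measure X}

lemma IsPoissonProcess.measurable (h : IsPoissonProcess η P μ) :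
    Measurable (fun ω => Config.mk (η ω)) :=
  Config.measurable_of_encard h.measurable_count

lemma IsPoissonProcess.iIndepFun_encard (h : IsPoissonProcess η P μ) {ι : Type*} [Finite ι]
    (B : ι → Set X) (hB : ∀ i, MeasurableSet (B i)) (hd : Pairwise (Function.onFun Disjoint B)) :
    iIndepFun (fun i ω => (η ω ∩ B i).encard) P := by
  obtain ⟨n, ⟨e⟩⟩ := Finite.exists_equiv_fin ι
  have := h.indep_count n (fun i => B (e.symm i)) (fun i => hB _)
    (fun i j hij => hd (by simpa using hij))
  have h2 := this.precomp e.injective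
  simpa using h2

lemma measurableSet_patternCell {A : Set X} (hA : MeasurableSet A) {ι : Type*} [Finite ι]
    {B : ι → Set X} (hB : ∀ i, MeasurableSet (B i)) (b : ι → Bool) :
    MeasurableSet (patternCell A B b) := by
  refine hA.inter ?_
  rw [Set.ofPred_forall]
  refine MeasurableSet.iInter fun i => ?_
  cases b i
  · convert (hB i).compl using 1
    ext x; simp
  · convert hB i using 1
    ext x; simp

lemma IsPoissonProcess.indepFun_tuple (h : IsPoissonProcess η P μ) {A A' : Set X}
    (hA : MeasurableSet A) (hA' : MeasurableSet A') (hd : Disjoint A A')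
    {ι ι' : Type*} [Finite ι] [Finite ι'] (B : ι → Set X) (B' : ι' → Set X)
    (hB : ∀ i, MeasurableSet (B i)) (hB' : ∀ i, MeasurableSet (B' i)) :
    IndepFun (fun ω i => (η ω ∩ A ∩ B i).encard) (fun ω i => (η ω ∩ A' ∩ B' i).encard) P := by
  classical
  have := Fintype.ofFinite ι
  have := Fintype.ofFinite ι'
  let C : (ι → Bool) ⊕ (ι' → Bool) → Set X :=
    Sum.elim (fun b => patternCell A B b) (fun b => patternCell A' B' b)
  have hC : ∀ i, MeasurableSet (C i) := by
    rintro (b | b)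
    · exact measurableSet_patternCell hA hB b
    · exact measurableSet_patternCell hA' hB' b
  have hCd : Pairwise (Function.onFun Disjoint C) := by
    rintro (b | b) (c | c) hbc
    · exact disjoint_patternCell (fun h => hbc (by rw [h]))
    · exact hd.mono Set.inter_subset_left Set.inter_subset_left
    · exact hd.symm.mono Set.inter_subset_left Set.inter_subset_left
    · exact disjoint_patternCell (fun h => hbc (by rw [h]))
  have hind := h.iIndepFun_encard C hC hCd
  let S₁ : Finset ((ι → Bool) ⊕ (ι' → Bool)) := Finset.univ.map Function.Embedding.inl
  let S₂ : Finset ((ι → Bool) ⊕ (ι' → Bool)) := Finset.univ.map Function.Embedding.inr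
  have hfin := hind.indepFun_finset S₁ S₂
    (by
      rw [Finset.disjoint_left]
      intro x hx hx'
      simp only [S₁, S₂, Finset.mem_map, Finset.mem_univ, true_and] at hx hx'
      obtain ⟨a, rfl⟩ := hx
      obtain ⟨b, hb⟩ := hx'
      cases hb)
    (fun i => h.measurable_count _ (hC i))
  have hcomp := hfin.comp
    (φ := fun (v : {x // x ∈ S₁} → ℕ∞) (i : ι) => ∑ b : ι → Bool, if b i = true
      then v ⟨Sum.inl b, by simp [S₁]⟩ else 0)
    (ψ := fun (v : {x // x ∈ S₂} → ℕ∞) (i : ι') => ∑ b : ι' → Bool, if b i = true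
      then v ⟨Sum.inr b, by simp [S₂]⟩ else 0)
    (by
      refine measurable_pi_iff.2 fun i => Finset.measurable_sum _ fun b _ => ?_
      split_ifs
      · exact measurable_pi_apply _
      · exact measurable_const)
    (by
      refine measurable_pi_iff.2 fun i => Finset.measurable_sum _ fun b _ => ?_
      split_ifs
      · exact measurable_pi_apply _
      · exact measurable_const)
  convert hcomp using 1
  · funext ω i
    exact encard_inter_patternCell (η ω) A B i
  · funext ω i
    exact encard_inter_patternCell (η ω) A' B' i

/-- The σ-algebra generated by the number of points of `η` in `A ∩ B`. -/
abbrev countSpace (η : Ω → Set X) (A : Set X) (B : {B : Set X // MeasurableSet B}) :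
    MeasurableSpace Ω :=
  MeasurableSpace.comap (fun ω => (η ω ∩ A ∩ B.1).encard) ⊤

/-- The restrictions of a Poisson process to disjoint sets are independent random
configurations. -/
theorem IsPoissonProcess.indepFun_inter [IsProbabilityMeasure P] (h : IsPoissonProcess η P μ)
    {A A' : Set X} (hA : MeasurableSet A) (hA' : MeasurableSet A') (hd : Disjoint A A') :
    IndepFun (fun ω => Config.mk (η ω ∩ A))
      (fun ω => Config.mk (η ω ∩ A')) P := by
  have hle : ∀ A : Set X, MeasurableSet A →
      MeasurableSpace.comap (fun ω => Config.mk (η ω ∩ A)) inferInstance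
        ≤ (inferInstance : MeasurableSpace Ω) := fun A hA =>
    ((Config.measurable_inter hA).comp h.measurable).comap_le
  have hgen : ∀ A : Set X,
      MeasurableSpace.comap (fun ω => Config.mk (η ω ∩ A)) inferInstance
        = MeasurableSpace.generateFrom (piiUnionInter (fun B => {s | MeasurableSet[countSpace η A B] s})
            Set.univ) := by
    intro A
    rw [generateFrom_piiUnionInter_measurableSet (countSpace η A) Set.univ, Config.comap_eq_iSup]
    simp [countSpace]
  have hpi : ∀ A : Set X, IsPiSystem (piiUnionInter (fun B => {s | MeasurableSet[countSpace η A B] s})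
            Set.univ) := fun A =>
    isPiSystem_piiUnionInter _ (fun B => @MeasurableSpace.isPiSystem_measurableSet _
      (countSpace η A B)) _
  rw [IndepFun_iff_Indep]
  refine IndepSets.indep (hle A hA) (hle A' hA') (hpi A) (hpi A') (hgen A) (hgen A') ?_
  rw [IndepSets_iff]
  -- a member of the π-system is an event on finitely many counts
  have hrep : ∀ (A : Set X) (s : Set Ω), s ∈ piiUnionInter (fun B => {s | MeasurableSet[countSpace η A B] s})
            Set.univ → ∃ (F : Finset {B : Set X // MeasurableSet B}) (T : F → Set ℕ∞),
        s = (fun ω (i : F) => (η ω ∩ A ∩ i.1.1).encard) ⁻¹' (Set.univ.pi T) := by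
    rintro A s ⟨F, -, f, hf, rfl⟩
    choose! T hT using hf
    refine ⟨F, fun i => T i.1, ?_⟩
    ext ω
    simp only [Set.mem_iInter, Set.mem_preimage, Set.mem_pi, Set.mem_univ, true_imp_iff]
    constructor
    · rintro hx ⟨i, hi⟩
      have := hx i hi
      rw [← (hT i hi).2] at this
      exact this
    · intro hx i hi
      rw [← (hT i hi).2]
      exact hx ⟨i, hi⟩
  intro s t hs ht
  obtain ⟨F, T, rfl⟩ := hrep A s hs
  obtain ⟨F', T', rfl⟩ := hrep A' t ht
  have hI := h.indepFun_tuple hA hA' hd (fun i : F => i.1.1) (fun i : F' => i.1.1)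
    (fun i => i.1.2) (fun i => i.1.2)
  exact hI.measure_inter_preimage_eq_mul _ _
    (MeasurableSet.univ_pi fun i => MeasurableSet.of_discrete)
    (MeasurableSet.univ_pi fun i => MeasurableSet.of_discrete)

/-- The probability that the numbers of points in finitely many disjoint sets of finite measure
lie in prescribed sets. -/
lemma IsPoissonProcess.measure_forall_encard (h : IsPoissonProcess η P μ)
    {ι : Type*} [Fintype ι] (B : ι → Set X) (hB : ∀ i, MeasurableSet (B i))
    (hd : Pairwise (Function.onFun Disjoint B)) (hfin : ∀ i, μ (B i) ≠ ⊤) (T : ι → Set ℕ∞) :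
    P {ω | ∀ i, (η ω ∩ B i).encard ∈ T i} =
      ∏ i, poissonMeasure (μ (B i)).toNNReal ((fun n : ℕ => (n : ℕ∞)) ⁻¹' T i) := by
  have hI := (h.iIndepFun_encard B hB hd).measure_inter_preimage_eq_mul Finset.univ
    (sets := T) (fun i _ => MeasurableSet.of_discrete)
  have hs : {ω | ∀ i, (η ω ∩ B i).encard ∈ T i}
      = ⋂ i ∈ Finset.univ, (fun ω => (η ω ∩ B i).encard) ⁻¹' T i := by
    ext ω; simp
  rw [hs, hI]
  refine Finset.prod_congr rfl fun i _ => ?_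
  rw [← Measure.map_apply (h.measurable_count _ (hB i)) MeasurableSet.of_discrete,
    h.map_count _ (hB i) (hfin i), Measure.map_apply (by fun_prop) MeasurableSet.of_discrete]

lemma IsPoissonProcess.ae_encard_lt_top (h : IsPoissonProcess η P μ) {B : Set X}
    (hB : MeasurableSet B) (hfin : μ B ≠ ⊤) : ∀ᵐ ω ∂P, (η ω ∩ B).encard < ⊤ := by
  have h1 : ∀ᵐ n ∂(P.map fun ω => (η ω ∩ B).encard), n < ⊤ := by
    rw [h.map_count B hB hfin, ae_map_iff (by fun_prop) MeasurableSet.of_discrete]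
    exact Filter.Eventually.of_forall fun n => ENat.natCast_lt_top n
  exact ae_of_ae_map (h.measurable_count B hB).aemeasurable h1

/-- The number of points of a Poisson process in a set of finite measure is square integrable. -/
lemma IsPoissonProcess.memLp_encard (h : IsPoissonProcess η P μ) {B : Set X}
    (hB : MeasurableSet B) (hfin : μ B ≠ ⊤) :
    MemLp (fun ω => ((η ω ∩ B).encard.toNat : ℝ)) 2 P := by
  have hm : Measurable (fun n : ℕ∞ => (n.toNat : ℝ)) := Measurable.of_discrete
  have h1 : MemLp (fun n : ℕ∞ => (n.toNat : ℝ)) 2 (P.map fun ω => (η ω ∩ B).encard) := by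
    rw [h.map_count B hB hfin, memLp_map_measure_iff hm.aestronglyMeasurable (by fun_prop)]
    rw [memLp_two_iff_integrable_sq (Measurable.of_discrete.aestronglyMeasurable), integrable_poissonMeasure_iff]
    set r : ℝ := ((μ B).toNNReal : ℝ)
    have hs : Summable fun n : ℕ => (n : ℝ) ^ 2 * r ^ n / n.factorial := by
      rw [← summable_nat_add_iff 2]
      have e : Summable fun n : ℕ => 4 * (r ^ 2 * (r ^ n / n.factorial)) :=
        ((Real.summable_pow_div_factorial r).mul_left _).mul_left _
      refine Summable.of_nonneg_of_le (fun n => by positivity) (fun n => ?_) e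
      rw [Nat.factorial_succ, Nat.factorial_succ]
      push_cast
      have hn : (0 : ℝ) < n.factorial := by positivity
      have hr : 0 ≤ r := by positivity
      have key : ((n : ℝ) + 2) ^ 2 ≤ 4 * ((n + 1 + 1) * (n + 1)) := by nlinarith
      rw [div_le_iff₀ (by positivity)]
      have : 4 * (r ^ 2 * (r ^ n / (n.factorial : ℝ))) * ((n + 1 + 1) * ((n + 1) * n.factorial))
          = (4 * ((n + 1 + 1) * (n + 1))) * r ^ (n + 2) := by
        field_simp; ring
      rw [this]
      gcongr
    refine (hs.mul_left (Real.exp (-r))).congr fun n => ?_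
    simp [r]
    try ring
  exact (memLp_map_measure_iff hm.aestronglyMeasurable
    (h.measurable_count B hB).aemeasurable).1 h1

/-- The image of a Poisson process under an isomorphism of measure spaces is a Poisson process. -/
lemma IsPoissonProcess.image {Y : Type*} [MeasurableSpace Y] {ν : Measure Y}
    (h : IsPoissonProcess η P μ) (e : X ≃ᵐ Y) (he : MeasurePreserving e μ ν) :
    IsPoissonProcess (fun ω => e '' η ω) P ν := by
  have key : ∀ (B : Set Y) ω, (e '' η ω ∩ B).encard = (η ω ∩ e ⁻¹' B).encard := fun B ω => by
    rw [← Set.image_inter_preimage, e.injective.encard_image]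
  refine ⟨fun B hB => ?_, fun B hB hfin => ?_, fun n B hB hd => ?_⟩
  · simpa only [key] using h.measurable_count _ (e.measurable hB)
  · have hm : μ (e ⁻¹' B) = ν B := he.measure_preimage hB.nullMeasurableSet
    simp only [key]
    rw [h.map_count _ (e.measurable hB) (by rwa [hm]), hm]
  · simp only [key]
    exact h.indep_count n _ (fun i => e.measurable (hB i))
      (fun i j hij => (hd i j hij).preimage _)

end Poisson

/-! ### Measurable enumeration of the points of a configuration -/

section Enumeration

lemma card_filter_le_iff (T : Finset ℝ) (i : Fin T.card) (r : ℝ) :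
    i.1 + 1 ≤ (T.filter (· ≤ r)).card ↔ T.orderEmbOfFin rfl i ≤ r := by
  set f := T.orderEmbOfFin rfl with hf
  constructor
  · intro h
    by_contra! hr
    have hsub : T.filter (· ≤ r) ⊆ (Finset.univ.filter (· < i)).image f := by
      intro x hx
      obtain ⟨hxT, hxr⟩ := Finset.mem_filter.1 hx
      obtain ⟨j, rfl⟩ : x ∈ Set.range f := by
        rw [hf, Finset.range_orderEmbOfFin]; exact hxT
      refine Finset.mem_image_of_mem _ (Finset.mem_filter.2 ⟨Finset.mem_univ _, ?_⟩)
      exact f.lt_iff_lt.1 (hxr.trans_lt hr)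
    have := (Finset.card_le_card hsub).trans Finset.card_image_le
    rw [show Finset.univ.filter (· < i) = Finset.Iio i by ext; simp, Fin.card_Iio] at this
    omega
  · intro h
    have hsub : (Finset.Iic i).image f ⊆ T.filter (· ≤ r) := by
      intro x hx
      obtain ⟨j, hj, rfl⟩ := Finset.mem_image.1 hx
      refine Finset.mem_filter.2 ⟨T.orderEmbOfFin_mem rfl j, ?_⟩
      exact (f.monotone (Finset.mem_Iic.1 hj)).trans h
    have := Finset.card_le_card hsub
    rwa [Finset.card_image_of_injective _ f.injective, Fin.card_Iic] at this

variable {X : Type*} [MeasurableSpace X] [StandardBorelSpace X] [Nonempty X]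

/-- The points of a configuration in `K`, if they are finitely many, can be enumerated in a
measurable way: embed `X` measurably into the real line; the `i`-th smallest value is at most `r`
if and only if there are more than `i` points with value at most `r`. -/
lemma exists_enumeration_of_finite {K : Set X} (hK : MeasurableSet K) :
    ∃ a : ℕ → Config X → X, (∀ i, Measurable (a i)) ∧
      ∀ S : Config X, (S.points ∩ K).encard < ⊤ →
        Set.BijOn (fun i => a i S) {i | (i : ℕ∞) < (S.points ∩ K).encard} (S.points ∩ K) := by
  classical
  set e := embeddingReal X
  have he : MeasurableEmbedding e := measurableEmbedding_embeddingReal X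
  obtain ⟨g, hg, hge⟩ := he.exists_measurable_extend measurable_id (fun _ => inferInstance)
  have hge' : ∀ x, g (e x) = x := fun x => congrFun hge x
  let V : ℕ → Set (Config X) :=
    fun i => {S | (i : ℕ∞) < (S.points ∩ K).encard ∧ (S.points ∩ K).encard < ⊤}
  let C : ℕ → Config X → Set ℝ := fun i S =>
    {r | ((i + 1 : ℕ) : ℕ∞) ≤ (S.points ∩ (K ∩ e ⁻¹' Set.Iic r)).encard}
  let b : ℕ → Config X → ℝ := fun i S => if S ∈ V i then sInf (C i S) else 0
  have hV : ∀ i, MeasurableSet (V i) := fun i =>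
    Config.measurable_encard hK (t := {n | (i : ℕ∞) < n ∧ n < ⊤}) MeasurableSet.of_discrete
  -- the `i`-th smallest value
  have key : ∀ (S : Config X) (T : Finset ℝ), (T : Set ℝ) = e '' (S.points ∩ K) →
      ∀ i : Fin T.card, C i S = Set.Ici (T.orderEmbOfFin rfl i) := by
    intro S T hT i
    ext r
    rw [Set.mem_Ici, ← card_filter_le_iff]
    have h1 : ((T.filter (· ≤ r) : Finset ℝ) : Set ℝ)
        = e '' (S.points ∩ (K ∩ e ⁻¹' Set.Iic r)) := by
      ext s
      simp only [Finset.coe_filter, Set.mem_ofPred_eq, ← Finset.mem_coe, hT]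
      constructor
      · rintro ⟨⟨x, hx, rfl⟩, hr⟩
        exact ⟨x, ⟨hx.1, hx.2, hr⟩, rfl⟩
      · rintro ⟨x, hx, rfl⟩
        exact ⟨⟨x, ⟨hx.1, hx.2.1⟩, rfl⟩, hx.2.2⟩
    have h2 : (S.points ∩ (K ∩ e ⁻¹' Set.Iic r)).encard = (T.filter (· ≤ r)).card := by
      rw [← he.injective.encard_image, ← h1, Set.encard_coe_eq_coe_finsetCard]
    change _ ≤ (S.points ∩ (K ∩ e ⁻¹' Set.Iic r)).encard ↔ _
    rw [h2, Nat.cast_le]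
  have hfin : ∀ S : Config X, (S.points ∩ K).encard < ⊤ → ∃ T : Finset ℝ,
      (T : Set ℝ) = e '' (S.points ∩ K) ∧ (S.points ∩ K).encard = T.card := by
    intro S hS
    have hf : (e '' (S.points ∩ K)).Finite := (Set.encard_lt_top_iff.1 hS).image _
    refine ⟨hf.toFinset, by simp, ?_⟩
    rw [← he.injective.encard_image, ← Set.encard_coe_eq_coe_finsetCard]
    simp
  have hb : ∀ (S : Config X) (T : Finset ℝ), (S.points ∩ K).encard < ⊤ →
      (T : Set ℝ) = e '' (S.points ∩ K) → (S.points ∩ K).encard = T.card →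
      ∀ i : Fin T.card, b i S = T.orderEmbOfFin rfl i := by
    intro S T hS hT hc i
    have hi : S ∈ V i := ⟨by rw [hc]; exact_mod_cast i.2, hS⟩
    simp only [b, if_pos hi]
    rw [key S T hT i, csInf_Ici]
  have hbm : ∀ i, Measurable (b i) := by
    intro i
    refine measurable_of_Iic fun r => ?_
    have : b i ⁻¹' Set.Iic r = (V i ∩ {S | ((i + 1 : ℕ) : ℕ∞) ≤
        (S.points ∩ (K ∩ e ⁻¹' Set.Iic r)).encard}) ∪ ((V i)ᶜ ∩ {_S | (0 : ℝ) ≤ r}) := by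
      ext S
      by_cases hS : S ∈ V i
      · obtain ⟨T, hT, hc⟩ := hfin S hS.2
        have hiT : i < T.card := by
          have := hS.1
          rw [hc] at this
          exact_mod_cast this
        have h1 := hb S T hS.2 hT hc ⟨i, hiT⟩
        have h2 : r ∈ C i S ↔ _ := Set.ext_iff.1 (key S T hT ⟨i, hiT⟩) r
        simp only [Set.mem_preimage, Set.mem_Iic, Set.mem_union, Set.mem_inter_iff, hS, true_and,
          Set.mem_compl_iff, not_true_eq_false, false_and, or_false]
        rw [h1]
        exact h2.symm
      · simp [b, hS]
    rw [this]
    refine ((hV i).inter ?_).union ((hV i).compl.inter (MeasurableSet.const _))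
    exact Config.measurable_encard (hK.inter (he.measurable measurableSet_Iic))
      (t := {n | ((i + 1 : ℕ) : ℕ∞) ≤ n}) MeasurableSet.of_discrete
  refine ⟨fun i S => g (b i S), fun i => hg.comp (hbm i), fun S hS => ?_⟩
  obtain ⟨T, hT, hc⟩ := hfin S hS
  have hb' := hb S T hS hT hc
  have hlt : ∀ i : ℕ, (i : ℕ∞) < (S.points ∩ K).encard ↔ i < T.card := fun i => by
    rw [hc]; exact Nat.cast_lt
  have hpt : ∀ i : Fin T.card, ∃ x ∈ S.points ∩ K, e x = T.orderEmbOfFin rfl i := by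
    intro i
    have : T.orderEmbOfFin rfl i ∈ (T : Set ℝ) := T.orderEmbOfFin_mem rfl i
    rw [hT] at this
    exact this
  refine ⟨?_, ?_, ?_⟩
  · intro i hi
    obtain ⟨x, hx, hxe⟩ := hpt ⟨i, (hlt i).1 hi⟩
    change g (b i S) ∈ _
    rw [hb' ⟨i, (hlt i).1 hi⟩, ← hxe, hge']
    exact hx
  · intro i hi j hj hij
    obtain ⟨x, hx, hxe⟩ := hpt ⟨i, (hlt i).1 hi⟩
    obtain ⟨y, hy, hye⟩ := hpt ⟨j, (hlt j).1 hj⟩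
    change g (b i S) = g (b j S) at hij
    rw [hb' ⟨i, (hlt i).1 hi⟩, hb' ⟨j, (hlt j).1 hj⟩, ← hxe, ← hye, hge', hge'] at hij
    rw [hij, hye] at hxe
    simpa using (T.orderEmbOfFin rfl).injective hxe.symm
  · intro x hx
    have hxT : e x ∈ (T : Set ℝ) := by rw [hT]; exact ⟨x, hx, rfl⟩
    rw [← Finset.range_orderEmbOfFin T rfl] at hxT
    obtain ⟨i, hi⟩ := hxT
    refine ⟨i, (hlt i).2 i.2, ?_⟩
    change g (b i S) = x
    rw [hb' i, hi, hge']

/-- The points of a locally finite configuration can be enumerated in a measurable way. -/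
lemma exists_enumeration {K : ℕ → Set X} (hK : ∀ m, MeasurableSet (K m))
    (hd : Pairwise (Function.onFun Disjoint K)) (hU : ⋃ m, K m = Set.univ) :
    ∃ (V : ℕ × ℕ → Set (Config X)) (a : ℕ × ℕ → Config X → X),
      (∀ i, MeasurableSet (V i)) ∧ (∀ i, Measurable (a i)) ∧
      ∀ S : Config X, (∀ m, (S.points ∩ K m).encard < ⊤) →
        Set.BijOn (fun i => a i S) {i | S ∈ V i} S.points := by
  choose a ha hbij using fun m => exists_enumeration_of_finite (hK m)
  refine ⟨fun i => {S | (i.2 : ℕ∞) < (S.points ∩ K i.1).encard}, fun i => a i.1 i.2,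
    fun i => Config.measurable_encard (hK i.1) (t := {n | (i.2 : ℕ∞) < n}) MeasurableSet.of_discrete,
    fun i => ha _ _, fun S hS => ⟨?_, ?_, ?_⟩⟩
  · intro i hi
    exact ((hbij i.1 S (hS i.1)).mapsTo hi).1
  · rintro ⟨m, i⟩ hi ⟨n, j⟩ hj hij
    have h1 := (hbij m S (hS m)).mapsTo hi
    have h2 := (hbij n S (hS n)).mapsTo hj
    change a m i S = a n j S at hij
    have hmn : m = n := by
      by_contra hmn
      refine Set.disjoint_left.1 (hd hmn) h1.2 ?_
      change a m i S ∈ K n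
      rw [hij]; exact h2.2
    subst hmn
    exact congrArg (Prod.mk m) ((hbij m S (hS m)).injOn hi hj hij)
  · intro x hx
    obtain ⟨m, hm⟩ := Set.mem_iUnion.1 (hU.symm ▸ Set.mem_univ x : x ∈ ⋃ m, K m)
    obtain ⟨i, hi, rfl⟩ := (hbij m S (hS m)).surjOn ⟨hx, hm⟩
    exact ⟨(m, i), hi, rfl⟩

end Enumeration

/-- The number of indices in a countable set for which a measurable condition holds is a measurable
function. -/
lemma measurable_encard_setOf {ι Ω : Type*} [Countable ι] [MeasurableSpace Ω]
    {p : ι → Ω → Prop} (hp : ∀ i, MeasurableSet {ω | p i ω}) :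
    Measurable fun ω => {i | p i ω}.encard := by
  have hfin : ∀ n : ℕ, MeasurableSet {ω | {i | p i ω}.encard = n} := by
    intro n
    have : {ω | {i | p i ω}.encard = n}
        = ⋃ F : Finset ι, {ω | F.card = n ∧ ∀ i, p i ω ↔ i ∈ F} := by
      ext ω
      simp only [Set.mem_ofPred_eq, Set.mem_iUnion]
      constructor
      · intro h
        have hf : {i | p i ω}.Finite := Set.finite_of_encard_eq_coe h
        refine ⟨hf.toFinset, ?_, fun i => by simp⟩
        rw [hf.encard_eq_coe_toFinset_card] at h
        exact_mod_cast h
      · rintro ⟨F, hF, hi⟩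
        have : {i | p i ω} = (F : Set ι) := by ext i; simp [hi]
        rw [this, Set.encard_coe_eq_coe_finsetCard, hF]
    rw [this]
    refine MeasurableSet.iUnion fun F => ?_
    have h2 : {ω | F.card = n ∧ ∀ i, p i ω ↔ i ∈ F}
        = {_ω | F.card = n} ∩ ⋂ i, {ω | p i ω ↔ i ∈ F} := by
      ext ω; simp
    rw [h2]
    refine (MeasurableSet.const _).inter (MeasurableSet.iInter fun i => ?_)
    by_cases hi : i ∈ F
    · simpa [hi] using hp i
    · have := (hp i).compl
      convert this using 1
      ext ω; simp [hi]
  refine measurable_to_countable' fun n => ?_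
  induction n using ENat.recTopCoe with
  | coe n => exact hfin n
  | top =>
    have : (fun ω => {i | p i ω}.encard) ⁻¹' {⊤} = (⋃ n : ℕ, {ω | {i | p i ω}.encard = n})ᶜ := by
      ext ω
      simp only [Set.mem_preimage, Set.mem_singleton_iff, Set.mem_compl_iff, Set.mem_iUnion,
        Set.mem_ofPred_eq, not_exists]
      exact ENat.eq_top_iff_forall_ne.trans ⟨fun h n hn => h n hn.symm, fun h n hn => h n hn.symm⟩
    rw [this]
    exact (MeasurableSet.iUnion hfin).compl

/-- The pairs of a point and a finite family of points with the first in the convex hull of the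
others form a closed set. -/
lemma isClosed_mem_convexHull_range {E : Type*} [NormedAddCommGroup E] [NormedSpace ℝ E]
    {κ : Type*} [Fintype κ] :
    IsClosed {q : E × (κ → E) | q.1 ∈ convexHull ℝ (Set.range q.2)} := by
  classical
  have : {q : E × (κ → E) | q.1 ∈ convexHull ℝ (Set.range q.2)}
      = Prod.fst '' {q : (E × (κ → E)) × stdSimplex ℝ κ |
          ∑ i, (q.2 : κ → ℝ) i • q.1.2 i = q.1.1} := by
    ext q
    have h : convexHull ℝ (Set.range q.2)
        = (Fintype.linearCombination ℝ q.2) '' stdSimplex ℝ κ := by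
      rw [← convexHull_basis_eq_stdSimplex, LinearMap.image_convexHull, ← Set.range_comp]
      congr 2
      funext i
      simp [Fintype.linearCombination_apply]
    simp only [Set.mem_ofPred_eq, h, Set.mem_image, Fintype.linearCombination_apply]
    constructor
    · rintro ⟨w, hw, hq⟩
      exact ⟨(q, ⟨w, hw⟩), hq, rfl⟩
    · rintro ⟨⟨q', w⟩, hq, rfl⟩
      exact ⟨w, w.2, hq⟩
  rw [this]
  have : CompactSpace (stdSimplex ℝ κ) := isCompact_iff_compactSpace.1 (isCompact_stdSimplex ℝ κ)
  refine isClosedMap_fst_of_compactSpace _ (isClosed_eq ?_ (by fun_prop))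
  refine continuous_finsetSum _ fun i _ => ?_
  exact ((continuous_apply i).comp (continuous_subtype_val.comp continuous_snd)).smul
    ((continuous_apply i).comp (continuous_snd.comp continuous_fst))

/-! ### Homogeneous spaces with a geodesic chart -/

/-- The properties that Euclidean and hyperbolic space share and on which the variance bound rests:
a metric, an origin and a measurable chart with values in `ℝ^d` in which geodesic segments are
straight segments (the identity for Euclidean space, the Klein model for hyperbolic space); the
chart covers the open unit ball and distorts distances to the origin by a factor of at most `2`;
every point can be moved to the origin by an isometry that preserves the volume. -/
structure GeodesicModel (d : ℕ) (X : Type*) [Dist X] [MeasureSpace X] where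
  /-- The origin. -/
  origin : X
  /-- The chart in which geodesics are straight. -/
  chart : X → EuclideanSpace ℝ (Fin d)
  dist_self : ∀ x : X, dist x x = 0
  dist_comm : ∀ x y : X, dist x y = dist y x
  dist_triangle : ∀ x y z : X, dist x z ≤ dist x y + dist y z
  measurable_dist : Measurable fun q : X × X => dist q.1 q.2
  measurable_chart : Measurable chart
  between_iff : ∀ x y z : X,
    dist x z + dist z y = dist x y ↔ chart z ∈ segment ℝ (chart x) (chart y)
  convex_range : Convex ℝ (Set.range chart)
  ball_subset_range : Metric.ball 0 1 ⊆ Set.range chart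
  norm_chart_le : ∀ x, ‖chart x‖ ≤ 2 * dist origin x
  dist_le : ∀ x, ‖chart x‖ ≤ 1 / 2 → dist origin x ≤ 2 * ‖chart x‖
  exists_on_geodesic : ∀ (y : X) (r : ℝ), 0 ≤ r → r ≤ dist origin y →
    ∃ w, dist origin w = r ∧ dist w y = dist origin y - r
  homogeneous : ∀ z : X, ∃ τ : X ≃ᵐ X,
    (∀ x y, dist (τ x) (τ y) = dist x y) ∧ MeasurePreserving τ ∧ τ z = origin
  volume_cball_lt_top : ∀ r : ℝ, volume (cball origin r) < ⊤
  volume_preimage_pos : ∀ U : Set (EuclideanSpace ℝ (Fin d)), IsOpen U →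
    (U ∩ Set.range chart).Nonempty → 0 < volume (chart ⁻¹' U)

lemma convHull_mono {X : Type*} [Dist X] {S T : Set X} (h : S ⊆ T) : convHull S ⊆ convHull T :=
  Set.sInter_subset_sInter fun _ hC => ⟨h.trans hC.1, hC.2⟩

namespace GeodesicModel

variable {d : ℕ} {X : Type*} [Dist X] [MeasureSpace X] (M : GeodesicModel d X)

include M

lemma measurableSet_cball (p : X) (r : ℝ) : MeasurableSet (cball p r) :=
  measurableSet_le (M.measurable_dist.comp (measurable_const.prodMk measurable_id))
    measurable_const

lemma geodConvex_preimage {C : Set (EuclideanSpace ℝ (Fin d))} (hC : Convex ℝ C) :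
    GeodConvex (M.chart ⁻¹' C) := fun x hx y hy z h =>
  hC.segment_subset hx hy ((M.between_iff x y z).1 h)

/-- The chart maps geodesic convex hulls to convex hulls. -/
lemma mem_convHull_iff (x : X) (S : Set X) :
    x ∈ convHull S ↔ M.chart x ∈ convexHull ℝ (M.chart '' S) := by
  constructor
  · intro h
    exact h (M.chart ⁻¹' convexHull ℝ (M.chart '' S))
      ⟨fun y hy => subset_convexHull ℝ _ ⟨y, hy, rfl⟩,
        M.geodConvex_preimage (convex_convexHull ℝ _)⟩
  · rintro h C ⟨hSC, hC⟩
    have hconv : Convex ℝ (M.chart '' C) := by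
      rw [convex_iff_segment_subset]
      rintro _ ⟨a, ha, rfl⟩ _ ⟨b, hb, rfl⟩ q hq
      obtain ⟨z, rfl⟩ := M.convex_range.segment_subset ⟨a, rfl⟩ ⟨b, rfl⟩ hq
      exact ⟨z, hC a ha b hb z ((M.between_iff a b z).2 hq), rfl⟩
    obtain ⟨y, hy, hyx⟩ := convexHull_min (Set.image_mono hSC) hconv h
    refine hC y hy y hy x ((M.between_iff y y x).2 ?_)
    rw [hyx]
    exact left_mem_segment ℝ _ _

/-! ### Measurability of the number of points of given outdegree -/

/-- The event that `a i S` lies in the convex hull of the points that come before `a l S`, for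
configurations `S` enumerated as the `a j S` with `S ∈ V j`. A convex hull is the union of the
convex hulls of finite subsets, which gives a countable union over finite sets of indices. -/
lemma measurableSet_mem_convHull {V : ℕ × ℕ → Set (Config X)} {a : ℕ × ℕ → Config X → X}
    (hV : ∀ i, MeasurableSet (V i)) (ha : ∀ i, Measurable (a i)) (i l : ℕ × ℕ)
    (hdiag : MeasurableSet {q : X × X | q.1 = q.2}) :
    MeasurableSet {S : Config X | a i S ∈ convHull {z | ∃ j, S ∈ V j ∧ a j S = z ∧ z ≠ a i S ∧
      dist (a i S) z < dist (a i S) (a l S)}} := by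
  classical
  have heq : {S : Config X | a i S ∈ convHull {z | ∃ j, S ∈ V j ∧ a j S = z ∧ z ≠ a i S ∧
      dist (a i S) z < dist (a i S) (a l S)}}
      = ⋃ F : Finset (ℕ × ℕ), (⋂ j ∈ F, V j ∩ {S | a j S ≠ a i S} ∩
          {S | dist (a i S) (a j S) < dist (a i S) (a l S)}) ∩
        {S | M.chart (a i S) ∈ convexHull ℝ (Set.range fun j : F => M.chart (a j.1 S))} := by
    ext S
    simp only [Set.mem_ofPred_eq, Set.mem_iUnion, Set.mem_inter_iff, Set.mem_iInter]
    rw [M.mem_convHull_iff]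
    constructor
    · intro h
      rw [convexHull_eq_union_convexHull_finite_subsets] at h
      simp only [Set.mem_iUnion] at h
      obtain ⟨t, hts, hxt⟩ := h
      have hj : ∀ q ∈ t, ∃ j, (S ∈ V j ∧ a j S ≠ a i S ∧
          dist (a i S) (a j S) < dist (a i S) (a l S)) ∧ M.chart (a j S) = q := by
        intro q hq
        obtain ⟨z, ⟨j, hjV, rfl, h1, h2⟩, rfl⟩ := hts hq
        exact ⟨j, ⟨hjV, h1, h2⟩, rfl⟩
      choose! f hf hfq using hj
      refine ⟨t.image f, fun j hj => ?_, ?_⟩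
      · obtain ⟨q, hq, rfl⟩ := Finset.mem_image.1 hj
        exact ⟨⟨(hf q hq).1, (hf q hq).2.1⟩, (hf q hq).2.2⟩
      · refine convexHull_mono ?_ hxt
        intro q hq
        exact ⟨⟨f q, Finset.mem_image_of_mem f hq⟩, hfq q hq⟩
    · rintro ⟨F, hF, hx⟩
      refine convexHull_mono ?_ hx
      rintro _ ⟨⟨j, hj⟩, rfl⟩
      exact ⟨a j S, ⟨j, (hF j hj).1.1, rfl, (hF j hj).1.2, (hF j hj).2⟩, rfl⟩
  rw [heq]
  refine MeasurableSet.iUnion fun F => (Finset.measurableSet_biInter F fun j _ => ?_).inter ?_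
  · refine ((hV j).inter ?_).inter ?_
    · exact (((ha j).prodMk (ha i)) hdiag).compl
    · exact measurableSet_lt (M.measurable_dist.comp ((ha i).prodMk (ha j)))
        (M.measurable_dist.comp ((ha i).prodMk (ha l)))
  · have hm : Measurable fun S => (M.chart (a i S), fun j : F => M.chart (a j.1 S)) :=
      (M.measurable_chart.comp (ha i)).prodMk
        (measurable_pi_iff.2 fun j => M.measurable_chart.comp (ha j.1))
    exact hm isClosed_mem_convexHull_range.measurableSet

/-- A configuration is locally finite if it has finitely many points in each ball. -/
def LocFinite (S : Set X) : Prop := ∀ n : ℕ, (S ∩ cball M.origin n).encard < ⊤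

variable {M} in
lemma LocFinite.mono {S T : Set X} (hT : M.LocFinite T) (h : S ⊆ T) :
    M.LocFinite S := fun n =>
  (Set.encard_le_encard (Set.inter_subset_inter_left _ h)).trans_lt (hT n)

lemma cball_subset_cball (p q : X) {r s : ℝ} (h : dist q p + r ≤ s) : cball p r ⊆ cball q s :=
  fun x hx => by
    have := M.dist_triangle q p x
    have hx' : dist p x ≤ r := hx
    change dist q x ≤ s
    linarith

variable {M} in
lemma LocFinite.encard_inter_cball_lt_top {S : Set X}
    (hS : M.LocFinite S) (p : X) (t : ℝ) : (S ∩ cball p t).encard < ⊤ := by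
  obtain ⟨n, hn⟩ := exists_nat_ge (dist M.origin p + t)
  exact (Set.encard_le_encard
    (Set.inter_subset_inter_right _ (M.cball_subset_cball p M.origin hn))).trans_lt (hS n)

/-- On locally finite configurations, the number of points of outdegree `k` in a ball is a
measurable function. -/
theorem exists_measurable_outdegCount [StandardBorelSpace X] (k : ℕ) (p : X) (t : ℝ) :
    ∃ g : Config X → ℝ, Measurable g ∧
      ∀ S : Config X, M.LocFinite S.points → g S = outdegCount k p t S.points := by
  have : Nonempty X := ⟨M.origin⟩
  let K : ℕ → Set X := disjointed fun n : ℕ => cball M.origin n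
  have hKm : ∀ m, MeasurableSet (K m) :=
    fun m => MeasurableSet.disjointed (fun n => M.measurableSet_cball _ _) m
  have hKU : ⋃ m, K m = Set.univ := by
    rw [iUnion_disjointed]
    refine Set.eq_univ_of_forall fun x => ?_
    obtain ⟨n, hn⟩ := exists_nat_ge (dist M.origin x)
    exact Set.mem_iUnion.2 ⟨n, hn⟩
  obtain ⟨V, a, hV, ha, hbij⟩ := exists_enumeration hKm (disjoint_disjointed _) hKU
  have hdiag : MeasurableSet {q : X × X | q.1 = q.2} := by
    exact measurableSet_eq_fun measurable_fst measurable_snd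
  -- `a l S` is an outgoing neighbour of `a i S`
  let Q : ℕ × ℕ → ℕ × ℕ → Config X → Prop := fun i l S => S ∈ V l ∧ a l S ≠ a i S ∧
    a i S ∉ convHull {z | ∃ j, S ∈ V j ∧ a j S = z ∧ z ≠ a i S ∧
      dist (a i S) z < dist (a i S) (a l S)}
  have hQ : ∀ i l, MeasurableSet {S | Q i l S} := fun i l =>
    (hV l).inter ((((ha l).prodMk (ha i)) hdiag).compl.inter
      (M.measurableSet_mem_convHull hV ha i l hdiag).compl)
  let R : ℕ × ℕ → Config X → Prop := fun i S =>
    S ∈ V i ∧ a i S ∈ cball p t ∧ {l | Q i l S}.encard = k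
  have hR : ∀ i, MeasurableSet {S | R i S} := fun i =>
    (hV i).inter ((ha i (M.measurableSet_cball p t)).inter
      (measurable_encard_setOf (hQ i) (measurableSet_singleton (k : ℕ∞))))
  refine ⟨fun S => ({i | R i S}.encard.toNat : ℝ), ?_, fun S hS => ?_⟩
  · have : Measurable (fun n : ℕ∞ => (n.toNat : ℝ)) := Measurable.of_discrete
    exact this.comp (measurable_encard_setOf hR)
  have hb := hbij S fun m => (Set.encard_le_encard (Set.inter_subset_inter_right _
    (disjointed_subset (fun n : ℕ => cball M.origin n) m))).trans_lt (hS m)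
  have hpts : ∀ z, z ∈ S.points ↔ ∃ j, S ∈ V j ∧ a j S = z := fun z => by
    rw [← hb.image_eq]; rfl
  have hcl : ∀ i l, {z | ∃ j, S ∈ V j ∧ a j S = z ∧ z ≠ a i S ∧
      dist (a i S) z < dist (a i S) (a l S)}
      = {z | z ∈ S.points ∧ z ≠ a i S ∧ dist (a i S) z < dist (a i S) (a l S)} := by
    intro i l
    ext z
    simp only [Set.mem_ofPred_eq, hpts z]
    constructor
    · rintro ⟨j, h1, h2, h3⟩; exact ⟨⟨j, h1, h2⟩, h3⟩
    · rintro ⟨⟨j, h1, h2⟩, h3⟩; exact ⟨j, h1, h2, h3⟩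
  have hQdeg : ∀ i, {l | Q i l S}.encard = outdeg (a i S) S.points := by
    intro i
    have : outNeighbours (a i S) S.points = (fun l => a l S) '' {l | Q i l S} := by
      ext y
      simp only [outNeighbours, Set.mem_ofPred_eq, Set.mem_image, hpts y]
      constructor
      · rintro ⟨⟨l, hl, rfl⟩, h2, h3⟩
        exact ⟨l, ⟨hl, h2, by rwa [hcl]⟩, rfl⟩
      · rintro ⟨l, ⟨hl, h2, h3⟩, rfl⟩
        exact ⟨⟨l, hl, rfl⟩, h2, by rwa [hcl] at h3⟩
    rw [outdeg, this]
    exact (hb.injOn.mono fun l hl => hl.1).encard_image.symm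
  have hRset : {x | x ∈ S.points ∧ x ∈ cball p t ∧ outdeg x S.points = k}
      = (fun i => a i S) '' {i | R i S} := by
    ext y
    simp only [Set.mem_ofPred_eq, Set.mem_image, hpts y]
    constructor
    · rintro ⟨⟨i, hi, rfl⟩, h2, h3⟩
      exact ⟨i, ⟨hi, h2, by rwa [hQdeg]⟩, rfl⟩
    · rintro ⟨i, ⟨hi, h2, h3⟩, rfl⟩
      exact ⟨⟨i, hi, rfl⟩, h2, by rwa [hQdeg] at h3⟩
  rw [outdegCount, hRset, Set.ncard, (hb.injOn.mono fun i hi => hi.1).encard_image]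

/-- The number of points of outdegree `k` is at most the number of all points. -/
lemma outdegCount_le {S : Set X} (hS : M.LocFinite S) (k : ℕ) (p : X) (t : ℝ) :
    outdegCount k p t S ≤ ((S ∩ cball p t).encard.toNat : ℝ) := by
  rw [outdegCount, Nat.cast_le]
  exact Set.ncard_le_ncard (fun x hx => ⟨hx.1, hx.2.1⟩)
    (Set.encard_lt_top_iff.1 (hS.encard_inter_cball_lt_top p t))

end GeodesicModel

/-! ### Lorentz boosts -/

namespace HypSpace

variable {d : ℕ}

local notation "𝔼" => EuclideanSpace ℝ (Fin d)

/-- The time coordinate of the point of the hyperboloid with spatial coordinates `v`. -/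
def lift (v : 𝔼) : ℝ := Real.sqrt (1 + ‖v‖ ^ 2)

lemma lift_sq (v : 𝔼) : lift v ^ 2 = 1 + ‖v‖ ^ 2 := Real.sq_sqrt (by positivity)

lemma lift_pos (v : 𝔼) : 0 < lift v := Real.sqrt_pos.2 (by positivity)

lemma lift_zero : lift (0 : 𝔼) = 1 := by simp [lift]

lemma lift_neg (v : 𝔼) : lift (-v) = lift v := by simp [lift]

lemma one_le_lift (v : 𝔼) : 1 ≤ lift v := by
  have := lift_sq v
  nlinarith [lift_pos v, sq_nonneg ‖v‖]

lemma norm_lt_lift (v : 𝔼) : ‖v‖ < lift v := by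
  have := lift_sq v
  nlinarith [lift_pos v, norm_nonneg v]

/-- Minus the Minkowski product of two points of the hyperboloid. -/
def mink (v w : 𝔼) : ℝ := lift v * lift w - inner ℝ v w

lemma one_add_norm_mul_le (v w : 𝔼) : 1 + ‖v‖ * ‖w‖ ≤ lift v * lift w := by
  have h1 := lift_sq v
  have h2 := lift_sq w
  have h3 := mul_pos (lift_pos v) (lift_pos w)
  refine abs_le_of_sq_le_sq' ?_ h3.le |>.2
  have : (lift v * lift w) ^ 2 = (1 + ‖v‖ ^ 2) * (1 + ‖w‖ ^ 2) := by rw [mul_pow, h1, h2]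
  rw [this]
  nlinarith [sq_nonneg (‖v‖ - ‖w‖)]

lemma one_le_mink (v w : 𝔼) : 1 ≤ mink v w := by
  have := one_add_norm_mul_le v w
  have := real_inner_le_norm v w
  unfold mink
  linarith

/-- The hyperbolic distance in terms of spatial coordinates. -/
def hdist (v w : 𝔼) : ℝ := Real.arcosh (mink v w)

lemma cosh_hdist (v w : 𝔼) : Real.cosh (hdist v w) = mink v w :=
  Real.cosh_arcosh (one_le_mink v w)

lemma hdist_nonneg (v w : 𝔼) : 0 ≤ hdist v w := Real.arcosh_nonneg (one_le_mink v w)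

lemma hdist_eq_of_cosh {v w : 𝔼} {r : ℝ} (hr : 0 ≤ r) (h : mink v w = Real.cosh r) :
    hdist v w = r := by
  rw [hdist, h, Real.arcosh_cosh hr]

lemma mink_comm (v w : 𝔼) : mink v w = mink w v := by
  rw [mink, mink, mul_comm, real_inner_comm]

lemma hdist_comm (v w : 𝔼) : hdist v w = hdist w v := by rw [hdist, mink_comm, hdist]

lemma mink_self (v : 𝔼) : mink v v = 1 := by
  rw [mink, real_inner_self_eq_norm_sq, ← sq, lift_sq]; ring

lemma hdist_self (v : 𝔼) : hdist v v = 0 := by rw [hdist, mink_self, Real.arcosh_zero]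

lemma cosh_hdist_zero (v : 𝔼) : Real.cosh (hdist 0 v) = lift v := by
  rw [cosh_hdist, mink, lift_zero]; simp

lemma sinh_hdist_zero (v : 𝔼) : Real.sinh (hdist 0 v) = ‖v‖ := by
  have h := Real.cosh_sq (hdist 0 v)
  rw [cosh_hdist_zero, lift_sq] at h
  have h1 : 0 ≤ Real.sinh (hdist 0 v) := Real.sinh_nonneg_iff.2 (hdist_nonneg 0 v)
  exact (pow_left_inj₀ h1 (norm_nonneg v) two_ne_zero).1 (by linarith)

/-- The Lorentz boost that maps the point with spatial coordinates `b` to the origin, in spatial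
coordinates. -/
def boost (b v : 𝔼) : 𝔼 := v + (inner ℝ b v / (1 + lift b) - lift v) • b

lemma norm_sq_eq (v : 𝔼) : ‖v‖ ^ 2 = lift v ^ 2 - 1 := by rw [lift_sq]; ring

lemma inner_boost (b v w : 𝔼) : inner ℝ (boost b v) (boost b w) =
    inner ℝ v w + (inner ℝ b v / (1 + lift b) - lift v) * inner ℝ b w
      + (inner ℝ b w / (1 + lift b) - lift w) * inner ℝ b v
      + (inner ℝ b v / (1 + lift b) - lift v) * (inner ℝ b w / (1 + lift b) - lift w)
        * (lift b ^ 2 - 1) := by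
  rw [← norm_sq_eq, ← real_inner_self_eq_norm_sq]
  simp only [boost, inner_add_left, inner_add_right, real_inner_smul_left, real_inner_smul_right]
  rw [real_inner_comm b v]
  ring

lemma lift_mul_sub_inner_pos (b v : 𝔼) : 0 < lift b * lift v - inner ℝ b v :=
  zero_lt_one.trans_le (one_le_mink b v)

lemma lift_boost (b v : 𝔼) : lift (boost b v) = lift b * lift v - inner ℝ b v := by
  have h1 : (1 : ℝ) + lift b ≠ 0 := by linarith [lift_pos b]
  have h : 1 + ‖boost b v‖ ^ 2 = (lift b * lift v - inner ℝ b v) ^ 2 := by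
    rw [← real_inner_self_eq_norm_sq, inner_boost, real_inner_self_eq_norm_sq, norm_sq_eq]
    field_simp
    ring
  rw [lift, h, Real.sqrt_sq (lift_mul_sub_inner_pos b v).le]

lemma mink_boost (b v w : 𝔼) : mink (boost b v) (boost b w) = mink v w := by
  have h1 : (1 : ℝ) + lift b ≠ 0 := by linarith [lift_pos b]
  rw [mink, mink, lift_boost, lift_boost, inner_boost]
  field_simp
  ring

lemma hdist_boost (b v w : 𝔼) : hdist (boost b v) (boost b w) = hdist v w := by
  rw [hdist, mink_boost, hdist]

lemma boost_neg_boost (b v : 𝔼) : boost (-b) (boost b v) = v := by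
  have h1 : (1 : ℝ) + lift b ≠ 0 := by linarith [lift_pos b]
  have h : inner ℝ (-b) (boost b v) / (1 + lift b) - (lift b * lift v - inner ℝ b v)
      = inner ℝ b v / (1 + lift b) - lift v := by
    rw [boost, inner_add_right, inner_neg_left, inner_neg_left, real_inner_smul_right,
      real_inner_self_eq_norm_sq, norm_sq_eq]
    field_simp
    ring
  rw [boost, lift_neg, lift_boost, h, boost]
  module

lemma boost_boost_neg (b v : 𝔼) : boost b (boost (-b) v) = v := by
  have := boost_neg_boost (-b) v
  rwa [neg_neg] at this

lemma boost_self (b : 𝔼) : boost b b = 0 := by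
  have h1 : (1 : ℝ) + lift b ≠ 0 := by linarith [lift_pos b]
  have h : inner ℝ b b / (1 + lift b) - lift b = -1 := by
    rw [real_inner_self_eq_norm_sq, norm_sq_eq]
    field_simp
    ring
  rw [boost, h]
  module

lemma continuous_lift : Continuous (lift : 𝔼 → ℝ) := by unfold lift; fun_prop

lemma continuous_boost (b : 𝔼) : Continuous (boost b) := by
  unfold boost
  have := continuous_lift (d := d)
  fun_prop

/-! ### Boosts preserve the hyperbolic volume -/

lemma hasFDerivAt_lift (v : 𝔼) : HasFDerivAt lift ((1 / lift v) • innerSL ℝ v) v := by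
  have h1 : HasFDerivAt (fun v : 𝔼 => 1 + ‖v‖ ^ 2) (2 • innerSL ℝ v) v :=
    (hasStrictFDerivAt_norm_sq v).hasFDerivAt.const_add 1
  have h2 := h1.sqrt (by positivity : (1 : ℝ) + ‖v‖ ^ 2 ≠ 0)
  have h3 : (1 / lift v) • innerSL ℝ v
      = (1 / (2 * Real.sqrt (1 + ‖v‖ ^ 2))) • 2 • innerSL ℝ v := by
    ext w
    simp only [lift, smul_apply, innerSL_apply_apply, smul_eq_mul, nsmul_eq_mul]
    field_simp
    push_cast
    ring
  rw [h3]
  exact h2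

/-- The derivative of a boost. -/
def boostDeriv (b v : 𝔼) : 𝔼 →L[ℝ] 𝔼 :=
  ContinuousLinearMap.id ℝ 𝔼 +
    ((1 / (1 + lift b)) • innerSL ℝ b - (1 / lift v) • innerSL ℝ v).smulRight b

lemma hasFDerivAt_boost (b v : 𝔼) : HasFDerivAt (boost b) (boostDeriv b v) v := by
  have h1 : HasFDerivAt (fun v : 𝔼 => (1 / (1 + lift b)) * inner ℝ b v)
      ((1 / (1 + lift b)) • innerSL ℝ b) v :=
    ((innerSL ℝ b).hasFDerivAt (x := v)).const_mul (1 / (1 + lift b))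
  have h2 := (hasFDerivAt_id (𝕜 := ℝ) v).add ((h1.sub (hasFDerivAt_lift v)).smul_const b)
  refine h2.congr_of_eventuallyEq (Filter.Eventually.of_forall fun w => ?_)
  simp only [boost, id, Pi.add_apply, Pi.sub_apply]
  congr 3
  ring

/-- The derivative of a boost is a rank one perturbation of the identity, and its determinant is
the ratio of the time coordinates of the image point and of the point. -/
lemma det_boostDeriv (b v : 𝔼) : (boostDeriv b v).det = lift (boost b v) / lift v := by
  have h1 : (1 : ℝ) + lift b ≠ 0 := by linarith [lift_pos b]
  have h2 : lift v ≠ 0 := (lift_pos v).ne'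
  have h : ((boostDeriv b v : 𝔼 →L[ℝ] 𝔼) : 𝔼 →ₗ[ℝ] 𝔼) = LinearMap.transvection
      (((1 / (1 + lift b)) • innerSL ℝ b - (1 / lift v) • innerSL ℝ v : 𝔼 →L[ℝ] ℝ) :
        𝔼 →ₗ[ℝ] ℝ) b := by
    ext w
    simp [boostDeriv, LinearMap.transvection]
  rw [ContinuousLinearMap.det, h, LinearMap.transvection.det, lift_boost]
  simp only [ContinuousLinearMap.coe_coe, sub_apply,
    smul_apply, innerSL_apply_apply, smul_eq_mul]
  rw [real_inner_self_eq_norm_sq, norm_sq_eq, real_inner_comm b v]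
  field_simp
  ring

/-- The hyperbolic volume in spatial coordinates. -/
def hvol (d : ℕ) : Measure (EuclideanSpace ℝ (Fin d)) :=
  (volume : Measure (EuclideanSpace ℝ (Fin d))).withDensity
    fun v => ENNReal.ofReal (1 / Real.sqrt (1 + ‖v‖ ^ 2))

lemma hvol_apply {A : Set 𝔼} (hA : MeasurableSet A) :
    hvol d A = ∫⁻ v in A, ENNReal.ofReal (1 / lift v) := withDensity_apply _ hA

lemma measurePreserving_boost (b : 𝔼) : MeasurePreserving (boost b) (hvol d) (hvol d) := by
  have hm : Measurable (boost b) := (continuous_boost b).measurable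
  refine ⟨hm, Measure.ext fun A hA => ?_⟩
  rw [Measure.map_apply hm hA, hvol_apply hA, hvol_apply (hm hA)]
  have hinj : Function.Injective (boost b) := fun v w h => by
    rw [← boost_neg_boost b v, h, boost_neg_boost]
  have hsurj : Function.Surjective (boost b) := fun v => ⟨_, boost_boost_neg b v⟩
  have h := lintegral_image_eq_lintegral_abs_det_fderiv_mul volume (hm hA)
    (fun v _ => (hasFDerivAt_boost b v).hasFDerivWithinAt) hinj.injOn
    (fun v => ENNReal.ofReal (1 / lift v))
  rw [Set.image_preimage_eq A hsurj] at h
  rw [h]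
  refine lintegral_congr fun v => ?_
  have h1 := lift_pos v
  have h2 := lift_pos (boost b v)
  rw [det_boostDeriv, ← ENNReal.ofReal_mul (abs_nonneg _), abs_of_pos (by positivity)]
  congr 1
  field_simp

/-! ### Hyperbolic segments -/

/-- `z` is a nonnegative combination of `x` and `y` in Minkowski space. -/
def ConicBetween (x z y : 𝔼) : Prop :=
  ∃ α β : ℝ, 0 ≤ α ∧ 0 ≤ β ∧ z = α • x + β • y ∧ lift z = α * lift x + β * lift y

lemma ConicBetween.boost {x z y : 𝔼} (h : ConicBetween x z y) (b : 𝔼) :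
    ConicBetween (boost b x) (boost b z) (boost b y) := by
  obtain ⟨α, β, hα, hβ, hz, hl⟩ := h
  refine ⟨α, β, hα, hβ, ?_, ?_⟩
  · simp only [HypSpace.boost]
    rw [hl, hz, inner_add_right, real_inner_smul_right, real_inner_smul_right]
    module
  · rw [lift_boost, lift_boost, lift_boost, hl, hz, inner_add_right, real_inner_smul_right,
      real_inner_smul_right]
    ring

lemma conicBetween_boost_iff {x z y : 𝔼} (b : 𝔼) :
    ConicBetween (HypSpace.boost b x) (HypSpace.boost b z) (HypSpace.boost b y)
      ↔ ConicBetween x z y := by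
  refine ⟨fun h => ?_, fun h => h.boost b⟩
  have := h.boost (-b)
  rwa [boost_neg_boost, boost_neg_boost, boost_neg_boost] at this

lemma conicBetween_zero_iff (x y : 𝔼) : ConicBetween x 0 y ↔ -inner ℝ x y = ‖x‖ * ‖y‖ := by
  constructor
  · rintro ⟨α, β, hα, hβ, hz, hl⟩
    rw [lift_zero] at hl
    rcases hα.lt_or_eq with hα | rfl
    · have hx : x = (-(β / α)) • y := by
        have : α • x = -(β • y) := eq_neg_of_add_eq_zero_left hz.symm
        calc x = α⁻¹ • (α • x) := by rw [smul_smul, inv_mul_cancel₀ hα.ne', one_smul]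
          _ = _ := by rw [this, smul_neg, smul_smul, neg_smul]; congr 2; field_simp
      have h0 : 0 ≤ β / α := by positivity
      rw [hx, real_inner_smul_left, norm_smul, real_inner_self_eq_norm_sq, norm_neg,
        Real.norm_of_nonneg h0]
      ring
    · have hβ : β ≠ 0 := by rintro rfl; simp at hl
      have hy : y = 0 := by
        have : β • y = 0 := by simpa using hz.symm
        exact (smul_eq_zero.1 this).resolve_left hβ
      simp [hy]
  · intro h
    have h1 : inner ℝ x (-y) = ‖x‖ * ‖-y‖ := by rw [inner_neg_right, norm_neg]; exact h
    rw [inner_eq_norm_mul_iff_real, norm_neg] at h1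
    by_cases hxy : x = 0 ∧ y = 0
    · refine ⟨1, 0, zero_le_one, le_rfl, ?_, ?_⟩ <;> simp [hxy.1]
    have hpos : 0 < ‖y‖ * lift x + ‖x‖ * lift y := by
      have hx := lift_pos x
      have hy := lift_pos y
      by_cases hx0 : x = 0
      · have : 0 < ‖y‖ := norm_pos_iff.2 fun h => hxy ⟨hx0, h⟩
        positivity
      · have : 0 < ‖x‖ := norm_pos_iff.2 hx0
        positivity
    refine ⟨‖y‖ / (‖y‖ * lift x + ‖x‖ * lift y), ‖x‖ / (‖y‖ * lift x + ‖x‖ * lift y),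
      by positivity, by positivity, ?_, ?_⟩
    · rw [div_eq_inv_mul, div_eq_inv_mul, mul_smul, mul_smul, ← smul_add, h1]
      simp
    · rw [lift_zero]
      field_simp

lemma mink_zero_split (x y : 𝔼) : Real.cosh (hdist x 0 + hdist 0 y)
    = lift x * lift y + ‖x‖ * ‖y‖ := by
  rw [Real.cosh_add, hdist_comm x 0, cosh_hdist_zero, cosh_hdist_zero, sinh_hdist_zero,
    sinh_hdist_zero]

lemma hdist_triangle_zero (x y : 𝔼) : hdist x y ≤ hdist x 0 + hdist 0 y := by
  have h0 : 0 ≤ hdist x 0 + hdist 0 y := add_nonneg (hdist_nonneg _ _) (hdist_nonneg _ _)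
  rw [← abs_of_nonneg (hdist_nonneg x y), ← abs_of_nonneg h0, ← Real.cosh_le_cosh,
    mink_zero_split, cosh_hdist, mink]
  have := neg_le_of_abs_le (abs_real_inner_le_norm x y)
  linarith

lemma hdist_add_zero_iff (x y : 𝔼) :
    hdist x 0 + hdist 0 y = hdist x y ↔ ConicBetween x 0 y := by
  have h0 : 0 ≤ hdist x 0 + hdist 0 y := add_nonneg (hdist_nonneg _ _) (hdist_nonneg _ _)
  rw [conicBetween_zero_iff]
  constructor
  · intro h
    have h1 := mink_zero_split x y
    rw [h, cosh_hdist, mink] at h1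
    linarith
  · intro h
    refine (hdist_eq_of_cosh h0 ?_).symm
    rw [mink_zero_split, mink, ← h]
    ring

lemma hdist_triangle (x y z : 𝔼) : hdist x z ≤ hdist x y + hdist y z := by
  rw [← hdist_boost y x z, ← hdist_boost y x y, ← hdist_boost y y z, boost_self]
  exact hdist_triangle_zero _ _

/-- The points on the hyperbolic segment from `x` to `y` are the points of the hyperboloid in the
convex cone spanned by `x` and `y`. -/
lemma hdist_add_iff (x y z : 𝔼) : hdist x z + hdist z y = hdist x y ↔ ConicBetween x z y := by
  rw [← conicBetween_boost_iff z, ← hdist_boost z x z, ← hdist_boost z z y, ← hdist_boost z x y,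
    boost_self]
  exact hdist_add_zero_iff _ _

/-! ### The Klein model -/

/-- The Klein model of hyperbolic space. -/
def klein (v : 𝔼) : 𝔼 := (1 / lift v) • v

lemma lift_smul_klein (v : 𝔼) : lift v • klein v = v := by
  have := (lift_pos v).ne'
  rw [klein, smul_smul, mul_one_div_cancel this, one_smul]

lemma conicBetween_iff_klein (x y z : 𝔼) :
    ConicBetween x z y ↔ klein z ∈ segment ℝ (klein x) (klein y) := by
  have hx := lift_pos x
  have hy := lift_pos y
  have hz := lift_pos z
  constructor
  · rintro ⟨α, β, hα, hβ, hz', hl⟩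
    refine ⟨α * lift x / lift z, β * lift y / lift z, by positivity, by positivity, ?_, ?_⟩
    · rw [← add_div, ← hl, div_self hz.ne']
    · rw [klein, klein, klein, smul_smul, smul_smul, hz', smul_add, smul_smul, smul_smul, ← hz']
      congr 2 <;> field_simp
  · rintro ⟨a, b, ha, hb, hab, h⟩
    refine ⟨a * lift z / lift x, b * lift z / lift y, by positivity, by positivity, ?_, ?_⟩
    · calc z = lift z • (a • klein x + b • klein y) := by rw [h, lift_smul_klein]
        _ = _ := by
          rw [klein, klein, smul_add, smul_smul, smul_smul, smul_smul, smul_smul]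
          congr 2 <;> ring
    · field_simp
      exact hab.symm

lemma norm_klein (v : 𝔼) : ‖klein v‖ = ‖v‖ / lift v := by
  rw [klein, norm_smul, Real.norm_of_nonneg (by have := lift_pos v; positivity)]
  ring

lemma range_klein : Set.range (klein : 𝔼 → 𝔼) = Metric.ball 0 1 := by
  ext w
  rw [mem_ball_zero_iff]
  constructor
  · rintro ⟨v, rfl⟩
    rw [norm_klein, div_lt_one (lift_pos v)]
    exact norm_lt_lift v
  · intro hw
    have h1 : 0 < 1 - ‖w‖ ^ 2 := by nlinarith [norm_nonneg w]
    set s := Real.sqrt (1 - ‖w‖ ^ 2) with hs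
    have hs0 : 0 < s := Real.sqrt_pos.2 h1
    have hs2 : s ^ 2 = 1 - ‖w‖ ^ 2 := Real.sq_sqrt h1.le
    have hl : lift ((1 / s) • w) = 1 / s := by
      rw [lift, norm_smul, Real.norm_of_nonneg (by positivity)]
      rw [Real.sqrt_eq_iff_mul_self_eq_of_pos (by positivity)]
      field_simp
      linarith
    refine ⟨(1 / s) • w, ?_⟩
    rw [klein, hl, smul_smul]
    have : 1 / (1 / s) * (1 / s) = 1 := by field_simp
    rw [this, one_smul]

lemma continuous_klein : Continuous (klein : 𝔼 → 𝔼) := by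
  unfold klein
  have := continuous_lift (d := d)
  exact (continuous_const.div this fun v => (lift_pos v).ne').smul continuous_id

lemma norm_klein_le (v : 𝔼) : ‖klein v‖ ≤ 2 * hdist 0 v := by
  rw [norm_klein, ← sinh_hdist_zero, ← cosh_hdist_zero]
  set D := hdist 0 v
  have hD : 0 ≤ D := hdist_nonneg 0 v
  rw [div_le_iff₀ (Real.cosh_pos D), Real.sinh_eq, Real.cosh_eq]
  have h1 : 1 - 2 * D ≤ Real.exp (-(2 * D)) := by
    have := Real.add_one_le_exp (-(2 * D)); linarith
  have h2 : Real.exp (-D) = Real.exp D * Real.exp (-(2 * D)) := by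
    rw [← Real.exp_add]; congr 1; ring
  have h3 := Real.exp_pos D
  have h4 := Real.exp_pos (-D)
  have h5 : Real.exp D * (1 - 2 * D) ≤ Real.exp (-D) := by
    rw [h2]; exact mul_le_mul_of_nonneg_left h1 h3.le
  nlinarith [mul_nonneg hD h4.le]

lemma hdist_le_norm_klein (v : 𝔼) (h : ‖klein v‖ ≤ 1 / 2) : hdist 0 v ≤ 2 * ‖klein v‖ := by
  rw [norm_klein] at h ⊢
  have hl := lift_pos v
  have hsq := lift_sq v
  have h1 : ‖v‖ ≤ lift v / 2 := by
    rw [div_le_iff₀ hl] at h; linarith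
  have h2 : lift v ≤ 2 := by nlinarith [norm_nonneg v]
  have h3 : hdist 0 v ≤ ‖v‖ := by
    rw [← sinh_hdist_zero]
    exact Real.self_le_sinh_iff.2 (hdist_nonneg 0 v)
  refine h3.trans ?_
  rw [← mul_div_assoc, le_div_iff₀ hl]
  nlinarith [norm_nonneg v]

lemma hdist_le_iff_norm (v : 𝔼) (r : ℝ) : hdist 0 v ≤ r ↔ ‖v‖ ≤ Real.sinh r := by
  rw [← sinh_hdist_zero, Real.sinh_le_sinh]

lemma exists_hdist_eq (y : 𝔼) (r : ℝ) (hr : 0 ≤ r) (hry : r ≤ hdist 0 y) :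
    ∃ w, hdist 0 w = r ∧ hdist w y = hdist 0 y - r := by
  by_cases hy : y = 0
  · subst hy
    rw [hdist_self] at hry ⊢
    have : r = 0 := le_antisymm hry hr
    exact ⟨0, by rw [hdist_self, this], by rw [hdist_self, this, sub_zero]⟩
  have hn : 0 < ‖y‖ := norm_pos_iff.2 hy
  have hs : 0 ≤ Real.sinh r := Real.sinh_nonneg_iff.2 hr
  set w : 𝔼 := (Real.sinh r / ‖y‖) • y
  have hw : ‖w‖ = Real.sinh r := by
    rw [norm_smul, Real.norm_of_nonneg (by positivity)]; field_simp
  have hlw : lift w = Real.cosh r := by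
    rw [lift, hw, add_comm, ← Real.cosh_sq, Real.sqrt_sq (Real.cosh_pos r).le]
  refine ⟨w, hdist_eq_of_cosh hr ?_, hdist_eq_of_cosh (by linarith) ?_⟩
  · rw [mink, lift_zero, hlw]; simp
  · rw [Real.cosh_sub, cosh_hdist_zero, sinh_hdist_zero, mink, hlw, real_inner_smul_left,
      real_inner_self_eq_norm_sq]
    field_simp

end HypSpace

/-! ### Hyperbolic and Euclidean space as models -/

namespace HypSpace

variable {d : ℕ}

instance : StandardBorelSpace (HypSpace d) :=
  inferInstanceAs (StandardBorelSpace (EuclideanSpace ℝ (Fin d)))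

lemma measurable_hdist :
    Measurable fun q : EuclideanSpace ℝ (Fin d) × EuclideanSpace ℝ (Fin d) =>
      hdist q.1 q.2 := by
  have h : Continuous fun q : EuclideanSpace ℝ (Fin d) × EuclideanSpace ℝ (Fin d) =>
      mink q.1 q.2 := by
    have := continuous_lift (d := d)
    unfold mink
    fun_prop
  exact (Real.continuousOn_arcosh.comp_continuous h fun q => one_le_mink q.1 q.2).measurable

/-- A boost as a measurable equivalence. -/
def boostEquiv (b : EuclideanSpace ℝ (Fin d)) :
    EuclideanSpace ℝ (Fin d) ≃ᵐ EuclideanSpace ℝ (Fin d) where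
  toFun := boost b
  invFun := boost (-b)
  left_inv := boost_neg_boost b
  right_inv := boost_boost_neg b
  measurable_toFun := (continuous_boost b).measurable
  measurable_invFun := (continuous_boost (-b)).measurable

lemma hvol_le : hvol d ≤ volume := by
  refine Measure.le_iff.2 fun A hA => ?_
  rw [hvol_apply hA]
  calc ∫⁻ v in A, ENNReal.ofReal (1 / lift v) ≤ ∫⁻ _ in A, 1 := by
        refine lintegral_mono fun v => ?_
        rw [← ENNReal.ofReal_one]
        refine ENNReal.ofReal_le_ofReal ?_
        rw [div_le_one (lift_pos v)]
        exact one_le_lift v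
    _ = volume A := by simp

lemma volume_le_hvol_zero {A : Set (EuclideanSpace ℝ (Fin d))} (h : hvol d A = 0) :
    volume A = 0 := by
  have hm : Measurable fun v : EuclideanSpace ℝ (Fin d) =>
      ENNReal.ofReal (1 / Real.sqrt (1 + ‖v‖ ^ 2)) := by fun_prop
  refine withDensity_absolutelyContinuous' hm.aemeasurable ?_ h
  exact Filter.Eventually.of_forall fun v =>
    (ENNReal.ofReal_pos.2 (by positivity)).ne'

/-- Hyperbolic space, with the Klein model as chart. -/
def model (d : ℕ) : GeodesicModel d (HypSpace d) where
  origin := (0 : EuclideanSpace ℝ (Fin d))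
  chart := fun x => klein x.vec
  dist_self := fun x => hdist_self x.vec
  dist_comm := fun x y => hdist_comm x.vec y.vec
  dist_triangle := fun x y z => hdist_triangle x.vec y.vec z.vec
  measurable_dist := measurable_hdist
  measurable_chart := continuous_klein.measurable
  between_iff := fun x y z =>
    (hdist_add_iff x.vec y.vec z.vec).trans (conicBetween_iff_klein x.vec y.vec z.vec)
  convex_range := by
    have : Set.range (fun x : HypSpace d => klein x.vec) = Metric.ball 0 1 := range_klein
    rw [this]
    exact convex_ball 0 1
  ball_subset_range := range_klein.symm.subset
  norm_chart_le := fun x => norm_klein_le x.vec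
  dist_le := fun x => hdist_le_norm_klein x.vec
  exists_on_geodesic := fun y r => exists_hdist_eq y.vec r
  homogeneous := fun z => ⟨boostEquiv z.vec, fun x y => hdist_boost z.vec x.vec y.vec,
    measurePreserving_boost z.vec, boost_self z.vec⟩
  volume_cball_lt_top := fun r => by
    refine (hvol_le _).trans_lt (lt_of_le_of_lt (measure_mono (t := Metric.closedBall 0
      (Real.sinh r)) fun v hv => ?_) measure_closedBall_lt_top)
    rw [mem_closedBall_zero_iff]
    exact (hdist_le_iff_norm v r).1 hv
  volume_preimage_pos := fun U hU hne => by
    obtain ⟨_, hvU, v, rfl⟩ := hne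
    have h : 0 < (volume : Measure (EuclideanSpace ℝ (Fin d))) (klein ⁻¹' U) :=
      (hU.preimage continuous_klein).measure_pos _ ⟨v, hvU⟩
    rw [pos_iff_ne_zero] at h ⊢
    exact fun h0 => h (volume_le_hvol_zero h0)

/-- The exponential lower bound for the volume of hyperbolic balls. -/
lemma exists_rhoHyp_le {γ : ℝ} (hγ : 0 < γ) :
    ∃ C : ℝ, 0 < C ∧ ∀ t : ℝ, 2 ≤ t →
      rhoHyp d γ t ≤ C * volume.real (cball (model d).origin t) := by
  set κ := (volume : Measure (EuclideanSpace ℝ (Fin d))).real (Metric.closedBall 0 1) with hκ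
  have hκ0 : 0 < κ := by
    rw [hκ, measureReal_def]
    exact ENNReal.toReal_pos (Metric.measure_closedBall_pos _ _ one_pos).ne'
      measure_closedBall_lt_top.ne
  refine ⟨γ * 4 ^ d / κ, by positivity, fun t ht => ?_⟩
  have hs : 0 < Real.sinh t := Real.sinh_pos_iff.2 (by linarith)
  -- the density is at least `1 / cosh t` on the ball
  have hvol : κ * Real.sinh t ^ d / Real.cosh t ≤ volume.real (cball (model d).origin t) := by
    have hball : {v : EuclideanSpace ℝ (Fin d) | hdist 0 v ≤ t}
        = Metric.closedBall 0 (Real.sinh t) := by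
      ext v
      rw [mem_closedBall_zero_iff]
      exact hdist_le_iff_norm v t
    have h1 : ENNReal.ofReal (κ * Real.sinh t ^ d / Real.cosh t)
        ≤ hvol d (Metric.closedBall 0 (Real.sinh t)) := by
      rw [hvol_apply Metric.isClosed_closedBall.measurableSet]
      calc ENNReal.ofReal (κ * Real.sinh t ^ d / Real.cosh t)
          = ∫⁻ _ in Metric.closedBall (0 : EuclideanSpace ℝ (Fin d)) (Real.sinh t),
              ENNReal.ofReal (1 / Real.cosh t) := by
            rw [setLIntegral_const, Measure.addHaar_closedBall' _ _ hs.le, finrank_euclideanSpace,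
              Fintype.card_fin, ← ENNReal.ofReal_toReal (a := volume (Metric.closedBall _ 1))
                measure_closedBall_lt_top.ne,
              ← ENNReal.ofReal_mul (by positivity), ← ENNReal.ofReal_mul (by positivity)]
            congr 1
            rw [hκ, measureReal_def]
            ring
        _ ≤ _ := by
            refine setLIntegral_mono' Metric.isClosed_closedBall.measurableSet fun v hv => ?_
            refine ENNReal.ofReal_le_ofReal ?_
            rw [mem_closedBall_zero_iff] at hv
            refine one_div_le_one_div_of_le (lift_pos v) ?_
            rw [lift]
            refine Real.sqrt_le_iff.2 ⟨(Real.cosh_pos t).le, ?_⟩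
            rw [Real.cosh_sq]
            nlinarith [norm_nonneg v]
    have h2 : volume.real (cball (model d).origin t)
        = (hvol d (Metric.closedBall 0 (Real.sinh t))).toReal := by
      rw [← hball]; rfl
    rw [h2, ← ENNReal.toReal_ofReal (r := κ * Real.sinh t ^ d / Real.cosh t)
      (by have := Real.cosh_pos t; positivity)]
    refine ENNReal.toReal_mono ?_ h1
    exact ((hvol_le _).trans_lt measure_closedBall_lt_top).ne
  have hc := Real.cosh_pos t
  refine le_trans ?_ (mul_le_mul_of_nonneg_left hvol (by positivity : 0 ≤ γ * 4 ^ d / κ))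
  rw [rhoHyp, if_pos ht]
  have h3 : Real.exp t ≤ 4 * Real.sinh t := by
    rw [Real.sinh_eq]
    have h5 : Real.exp (-t) ≤ 1 := Real.exp_le_one_iff.2 (by linarith)
    have h6 := Real.add_one_le_exp t
    linarith
  have h4 : Real.cosh t ≤ Real.exp t := by
    rw [Real.cosh_eq]
    have h5 : Real.exp (-t) ≤ Real.exp t := Real.exp_le_exp.2 (by linarith)
    linarith
  have h7 : Real.exp (t * ((d : ℝ) - 1)) * Real.exp t = Real.exp t ^ d := by
    rw [← Real.exp_add, ← Real.exp_nat_mul]; congr 1; ring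
  have h8 : Real.exp t ^ d ≤ (4 * Real.sinh t) ^ d :=
    pow_le_pow_left₀ (Real.exp_pos t).le h3 d
  have h9 : γ * 4 ^ d / κ * (κ * Real.sinh t ^ d / Real.cosh t)
      = γ * ((4 * Real.sinh t) ^ d / Real.cosh t) := by
    rw [mul_pow]; field_simp
  rw [h9]
  refine mul_le_mul_of_nonneg_left ?_ hγ.le
  rw [le_div_iff₀ hc]
  calc _ ≤ Real.exp (t * ((d : ℝ) - 1)) * Real.exp t := by gcongr
    _ ≤ _ := h7.trans_le h8

end HypSpace

/-- Euclidean space, with the identity as chart. -/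
def euclideanModel (d : ℕ) : GeodesicModel d (EuclideanSpace ℝ (Fin d)) where
  origin := 0
  chart := id
  dist_self := _root_.dist_self
  dist_comm := _root_.dist_comm
  dist_triangle := _root_.dist_triangle
  measurable_dist := measurable_dist
  measurable_chart := measurable_id
  between_iff := fun _ _ _ => dist_add_dist_eq_iff.trans mem_segment_iff_wbtw.symm
  convex_range := by rw [Set.range_id]; exact convex_univ
  ball_subset_range := by rw [Set.range_id]; exact Set.subset_univ _
  norm_chart_le := fun x => by
    rw [dist_zero_left]
    have := norm_nonneg x
    simp only [id]
    linarith
  dist_le := fun x _ => by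
    rw [dist_zero_left]
    have := norm_nonneg x
    simp only [id]
    linarith
  exists_on_geodesic := fun y r hr hry => by
    rw [dist_zero_left] at hry ⊢
    by_cases hy : y = 0
    · subst hy
      rw [norm_zero] at hry ⊢
      have : r = 0 := le_antisymm hry hr
      exact ⟨0, by simp [this], by simp [this]⟩
    have hn : 0 < ‖y‖ := norm_pos_iff.2 hy
    refine ⟨(r / ‖y‖) • y, ?_, ?_⟩
    · rw [dist_zero_left, norm_smul, Real.norm_of_nonneg (by positivity)]
      field_simp
    · have : (r / ‖y‖) • y - y = (-(1 - r / ‖y‖)) • y := by module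
      rw [dist_eq_norm, this, norm_smul, norm_neg, Real.norm_of_nonneg]
      · field_simp
      · rw [sub_nonneg, div_le_one hn]; exact hry
  homogeneous := fun z => ⟨MeasurableEquiv.subRight z, fun x y => dist_sub_right x y z,
    measurePreserving_sub_right volume z, sub_self z⟩
  volume_cball_lt_top := fun r => by
    refine lt_of_le_of_lt (measure_mono (t := Metric.closedBall 0 r) fun v hv => ?_)
      measure_closedBall_lt_top
    rw [Metric.mem_closedBall, _root_.dist_comm]
    exact hv
  volume_preimage_pos := fun U hU hne => by
    rw [Set.preimage_id]
    exact hU.measure_pos _ (hne.mono Set.inter_subset_left)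

lemma rhoEucl_eq {d : ℕ} (hd : 1 ≤ d) {t : ℝ} (ht : 0 ≤ t) :
    rhoEucl d t = volume.real (cball (0 : EuclideanSpace ℝ (Fin d)) t) := by
  have : Nonempty (Fin d) := ⟨⟨0, hd⟩⟩
  have hball : cball (0 : EuclideanSpace ℝ (Fin d)) t = Metric.closedBall 0 t := by
    ext v
    rw [Metric.mem_closedBall, _root_.dist_comm]
    exact Iff.rfl
  rw [hball, measureReal_def, EuclideanSpace.volume_closedBall, Fintype.card_fin, rhoEucl,
    ENNReal.toReal_mul, ENNReal.toReal_pow, ENNReal.toReal_ofReal ht, ENNReal.toReal_ofReal]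
  · have h : √Real.pi ^ d = Real.pi ^ ((d : ℝ) / 2) := by
      rw [Real.sqrt_eq_rpow, ← Real.rpow_natCast, ← Real.rpow_mul Real.pi_pos.le]
      congr 1
      ring
    rw [h, add_comm (1 : ℝ), mul_comm]
  · have := Real.Gamma_pos_of_pos (by positivity : 0 < (d : ℝ) / 2 + 1)
    positivity

namespace GeodesicModel

variable {d : ℕ} {X : Type*} [Dist X] [MeasureSpace X] (M : GeodesicModel d X)

include M

/-! ### Volumes of balls and separated sets -/

lemma volume_cball_eq (z : X) (r : ℝ) : volume (cball z r) = volume (cball M.origin r) := by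
  obtain ⟨τ, hτ, hm, hz⟩ := M.homogeneous z
  rw [← hm.measure_preimage (M.measurableSet_cball M.origin r).nullMeasurableSet]
  congr 1
  ext x
  change _ ↔ dist M.origin (τ x) ≤ r
  rw [← hz, hτ]
  rfl

lemma volume_cball_ne_top (z : X) (r : ℝ) : volume (cball z r) ≠ ⊤ := by
  rw [M.volume_cball_eq]; exact (M.volume_cball_lt_top r).ne

lemma chart_origin : M.chart M.origin = 0 := by
  have := M.norm_chart_le M.origin
  rw [M.dist_self, mul_zero] at this
  exact norm_le_zero_iff.1 this

lemma volume_cball_pos (z : X) {r : ℝ} (hr : 0 < r) : 0 < volume (cball z r) := by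
  rw [M.volume_cball_eq]
  refine (M.volume_preimage_pos (Metric.ball 0 (min (r / 2) (1 / 2))) Metric.isOpen_ball
    ⟨0, Metric.mem_ball_self (by positivity), M.origin, M.chart_origin⟩).trans_le
    (measure_mono fun x hx => ?_)
  have hx' : ‖M.chart x‖ < min (r / 2) (1 / 2) := by simpa using hx
  have h1 := M.dist_le x (hx'.trans_le (min_le_right _ _)).le
  have h2 := hx'.trans_le (min_le_left _ _)
  change dist M.origin x ≤ r
  linarith

lemma disjoint_cball {z w : X} {r s : ℝ} (h : r + s < dist z w) :
    Disjoint (cball z r) (cball w s) := by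
  rw [Set.disjoint_left]
  intro x hz hw
  have h1 := M.dist_triangle z x w
  rw [M.dist_comm x w] at h1
  have h2 : dist z x ≤ r := hz
  have h3 : dist w x ≤ s := hw
  linarith

/-- A bounded set contains a finite `s`-separated set that is maximal, so that it is an
`s`-net: the balls of radius `s / 2` around the points of an `s`-separated set are disjoint and have
the same volume, which bounds their number. -/
lemma exists_separated_net {K : Set X} {p : X} {r s : ℝ} (hK : K ⊆ cball p r) (hs : 0 < s) :
    ∃ F : Finset X, (F : Set X) ⊆ K ∧ (∀ z ∈ F, ∀ w ∈ F, z ≠ w → s < dist z w) ∧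
      ∀ x ∈ K, ∃ z ∈ F, dist z x ≤ s := by
  classical
  by_contra! hcon
  -- otherwise separated sets could be extended indefinitely
  have hgrow : ∀ n : ℕ, ∃ F : Finset X, (F : Set X) ⊆ K ∧
      (∀ z ∈ F, ∀ w ∈ F, z ≠ w → s < dist z w) ∧ F.card = n := by
    intro n
    induction n with
    | zero => exact ⟨∅, by simp⟩
    | succ n ih =>
      obtain ⟨F, hFK, hsep, hcard⟩ := ih
      obtain ⟨x, hxK, hx⟩ := hcon F hFK hsep
      have hxF : x ∉ F := fun h => by
        have := hx x h
        rw [M.dist_self] at this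
        linarith
      refine ⟨insert x F, ?_, ?_, by rw [Finset.card_insert_of_notMem hxF, hcard]⟩
      · rw [Finset.coe_insert]
        exact Set.insert_subset hxK hFK
      · intro z hz w hw hzw
        rcases Finset.mem_insert.1 hz with hzx | hz <;>
          rcases Finset.mem_insert.1 hw with hwx | hw
        · exact absurd (hzx.trans hwx.symm) hzw
        · rw [hzx, M.dist_comm]; exact hx w hw
        · rw [hwx]; exact hx z hz
        · exact hsep z hz w hw hzw
  set v := volume (cball M.origin (s / 2)) with hv
  have hv0 : 0 < v := M.volume_cball_pos _ (by linarith)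
  have hbound : ∀ n : ℕ, (n : ENNReal) * v ≤ volume (cball p (r + s / 2)) := by
    intro n
    obtain ⟨F, hFK, hsep, rfl⟩ := hgrow n
    calc (F.card : ENNReal) * v = ∑ z ∈ F, volume (cball z (s / 2)) := by
          simp only [M.volume_cball_eq, Finset.sum_const, nsmul_eq_mul, hv]
      _ = volume (⋃ z ∈ F, cball z (s / 2)) := by
          refine (measure_biUnion_finset (fun z hz w hw hzw => ?_)
            fun z _ => M.measurableSet_cball _ _).symm
          refine M.disjoint_cball ?_
          have := hsep z hz w hw hzw
          linarith
      _ ≤ _ := by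
          refine measure_mono (Set.iUnion₂_subset fun z hz => M.cball_subset_cball _ _ ?_)
          have : dist p z ≤ r := hK (hFK hz)
          linarith
  obtain ⟨n, hn⟩ := ENNReal.exists_nat_mul_gt hv0.ne' (M.volume_cball_ne_top p (r + s / 2))
  exact absurd (hbound n) (not_le.2 hn)

/-! ### Shielding -/

omit M [MeasureSpace X] in
/-- If more than `k` points of `S \ I` are closer to `y ∉ I` than all of `I`, then deleting the
points in `I` does not create the outdegree `k` at `y`: either `y` is in the convex hull of the
points that come before `I`, and its outgoing neighbours do not depend on the points in `I`, or
all these points are outgoing neighbours of `y`. -/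
lemma outdeg_eq_of_shielded {S I : Set X} {y : X} {k : ℕ}
    (hT : ((k + 1 : ℕ) : ℕ∞) ≤ {z | z ∈ S \ I ∧ z ≠ y ∧ ∀ i ∈ I, dist y z < dist y i}.encard)
    (h : outdeg y (S \ I) = k) : outdeg y S = k := by
  set T := {z | z ∈ S \ I ∧ z ≠ y ∧ ∀ i ∈ I, dist y z < dist y i} with hTdef
  by_cases hy : y ∈ convHull T
  · have hcl : ∀ w ∈ T, {z | z ∈ S ∧ z ≠ y ∧ dist y z < dist y w}
        = {z | z ∈ S \ I ∧ z ≠ y ∧ dist y z < dist y w} := by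
      intro w hw
      ext z
      constructor
      · rintro ⟨h1, h2, h3⟩
        exact ⟨⟨h1, fun hI => absurd (hw.2.2 z hI) (not_lt.2 h3.le)⟩, h2, h3⟩
      · rintro ⟨h1, h2, h3⟩
        exact ⟨h1.1, h2, h3⟩
    have hsub : ∀ S', S \ I ⊆ S' → S' ⊆ S → outNeighbours y S' ⊆ T := by
      rintro S' hS' hS'' w ⟨hwS, hwy, hw⟩
      by_contra hwT
      refine hw (convHull_mono ?_ hy)
      rintro z ⟨hzS, hzy, hz⟩
      refine ⟨hS' hzS, hzy, ?_⟩
      by_cases hwI : w ∈ I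
      · exact hz w hwI
      · have : ¬ ∀ i ∈ I, dist y w < dist y i := fun hall => hwT ⟨⟨hS'' hwS, hwI⟩, hwy, hall⟩
        push Not at this
        obtain ⟨i, hi, hiw⟩ := this
        exact (hz i hi).trans_le hiw
    have : outNeighbours y S = outNeighbours y (S \ I) := by
      ext w
      constructor
      · intro hw
        have hwT := hsub S Set.sdiff_subset le_rfl hw
        exact ⟨hwT.1, hw.2.1, by rw [← hcl w hwT]; exact hw.2.2⟩
      · intro hw
        have hwT := hsub (S \ I) le_rfl Set.sdiff_subset hw
        exact ⟨hwT.1.1, hw.2.1, by rw [hcl w hwT]; exact hw.2.2⟩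
    rw [outdeg, this]
    exact h
  · exfalso
    have hsub : T ⊆ outNeighbours y (S \ I) := by
      intro w hw
      refine ⟨hw.1, hw.2.1, fun hmem => hy (convHull_mono ?_ hmem)⟩
      rintro z ⟨h1, h2, h3⟩
      exact ⟨h1, h2, fun i hi => h3.trans (hw.2.2 i hi)⟩
    have := hT.trans (Set.encard_le_encard hsub)
    rw [← outdeg, h] at this
    have : k + 1 ≤ k := by exact_mod_cast this
    omega

/-- If each point outside `I` is shielded from `I`, then the points of outdegree `k` in `S \ I` keep
this outdegree in the presence of the points in `I`, and a point of outdegree `k` in `I` adds one to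
their number. -/
lemma outdegCount_add_one_le {S I : Set X} (hS : M.LocFinite S) {k : ℕ} {p : X} {t : ℝ}
    (hT : ∀ y ∈ S \ I,
      ((k + 1 : ℕ) : ℕ∞) ≤ {z | z ∈ S \ I ∧ z ≠ y ∧ ∀ i ∈ I, dist y z < dist y i}.encard)
    {x : X} (hxS : x ∈ S ∩ I) (hxt : x ∈ cball p t) (hx : outdeg x S = k) :
    outdegCount k p t (S \ I) + 1 ≤ outdegCount k p t S := by
  have hfin : {x | x ∈ S ∧ x ∈ cball p t ∧ outdeg x S = k}.Finite :=
    (Set.encard_lt_top_iff.1 (hS.encard_inter_cball_lt_top p t)).subset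
      fun x hx => ⟨hx.1, hx.2.1⟩
  have hsub : insert x {x | x ∈ S \ I ∧ x ∈ cball p t ∧ outdeg x (S \ I) = k}
      ⊆ {x | x ∈ S ∧ x ∈ cball p t ∧ outdeg x S = k} := by
    refine Set.insert_subset ⟨hxS.1, hxt, hx⟩ fun y hy => ?_
    exact ⟨hy.1.1, hy.2.1, outdeg_eq_of_shielded (hT y hy.1) hy.2.2⟩
  have hfin' := (hfin.subset hsub).subset (Set.subset_insert _ _)
  have hle := Set.ncard_le_ncard hsub hfin
  rw [Set.ncard_insert_of_notMem (fun h => h.1.2 hxS.2) hfin'] at hle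
  rw [outdegCount, outdegCount]
  exact_mod_cast hle

/-- The part of the ball of radius `3` around the origin that is neither in the unit ball nor near
the points of `F`. -/
def buffer (F : Finset X) : Set X :=
  cball M.origin 3 \ (cball M.origin 1 ∪ ⋃ w ∈ F, cball w (1 / 3))

lemma measurableSet_buffer (F : Finset X) : MeasurableSet (M.buffer F) :=
  (M.measurableSet_cball _ _).diff ((M.measurableSet_cball _ _).union
    (Finset.measurableSet_biUnion F fun _ _ => M.measurableSet_cball _ _))

lemma disjoint_cball_one {w : X} (hw : dist M.origin w = 3) :
    Disjoint (cball M.origin 1) (cball w (1 / 3)) :=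
  M.disjoint_cball (by rw [hw]; norm_num)

/-- Clusters of at least `k + 2` points near each point of a `1`-net of the sphere of radius `3`
shield the unit ball from all other points: the cluster in the direction of `y` is closer to `y`
than the unit ball. -/
lemma shielded_of_clusters {F : Finset X} (hF : ∀ w ∈ F, dist M.origin w = 3)
    (hnet : ∀ x, dist M.origin x = 3 → ∃ w ∈ F, dist w x ≤ 1) {S : Set X} {k : ℕ}
    (hbuf : (S ∩ M.buffer F).encard = 0)
    (hcl : ∀ w ∈ F, ((k + 2 : ℕ) : ℕ∞) ≤ (S ∩ cball w (1 / 3)).encard)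
    {y : X} (hy : y ∈ S \ cball M.origin 1) :
    ((k + 1 : ℕ) : ℕ∞) ≤ {z | z ∈ S \ cball M.origin 1 ∧ z ≠ y ∧
      ∀ i ∈ cball M.origin 1, dist y z < dist y i}.encard := by
  -- it suffices to find a cluster that is closer to `y` than the unit ball
  suffices h : ∃ w ∈ F, ∀ z ∈ cball w (1 / 3), ∀ i ∈ cball M.origin 1, dist y z < dist y i by
    obtain ⟨w, hw, hclose⟩ := h
    have hsub : (S ∩ cball w (1 / 3)) \ {y} ⊆ {z | z ∈ S \ cball M.origin 1 ∧ z ≠ y ∧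
        ∀ i ∈ cball M.origin 1, dist y z < dist y i} := by
      rintro z ⟨⟨hzS, hzw⟩, hzy⟩
      exact ⟨⟨hzS, fun hz1 => Set.disjoint_left.1 (M.disjoint_cball_one (hF w hw)) hz1 hzw⟩,
        hzy, hclose z hzw⟩
    refine le_trans ?_ (Set.encard_le_encard hsub)
    have h1 := (hcl w hw).trans (tsub_le_iff_right.1
      (Set.encard_tsub_one_le_encard_sdiff_singleton (S ∩ cball w (1 / 3)) y))
    have h2 : (((k + 1 : ℕ) : ℕ∞)) + 1 ≤ ((S ∩ cball w (1 / 3)) \ {y}).encard + 1 := by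
      refine le_trans (le_of_eq ?_) h1
      push_cast
      ring
    exact (ENat.add_le_add_iff_right ENat.one_ne_top).1 h2
  by_cases h3 : 3 ≤ dist M.origin y
  · obtain ⟨u, hu, huy⟩ := M.exists_on_geodesic y 3 (by norm_num) h3
    obtain ⟨w, hw, hwu⟩ := hnet u hu
    refine ⟨w, hw, fun z hz i hi => ?_⟩
    have hz' : dist w z ≤ 1 / 3 := hz
    have hi' : dist M.origin i ≤ 1 := hi
    have t1 := M.dist_triangle y u z
    have t2 := M.dist_triangle u w z
    have t3 := M.dist_triangle M.origin i y
    rw [M.dist_comm y u] at t1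
    rw [M.dist_comm u w] at t2
    rw [M.dist_comm i y] at t3
    linarith
  · have hyc : ∃ w ∈ F, y ∈ cball w (1 / 3) := by
      by_contra! hno
      rw [Set.encard_eq_zero] at hbuf
      have : y ∈ S ∩ M.buffer F := by
        refine ⟨hy.1, (not_le.1 h3).le, ?_⟩
        rintro (h | h)
        · exact hy.2 h
        · obtain ⟨w, hw, hyw⟩ := Set.mem_iUnion₂.1 h
          exact hno w hw hyw
      rw [hbuf] at this
      exact this
    obtain ⟨w, hw, hyw⟩ := hyc
    refine ⟨w, hw, fun z hz i hi => ?_⟩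
    have hz' : dist w z ≤ 1 / 3 := hz
    have hy' : dist w y ≤ 1 / 3 := hyw
    have hi' : dist M.origin i ≤ 1 := hi
    have hw3 := hF w hw
    have t1 := M.dist_triangle y w z
    have t2 := M.dist_triangle M.origin i w
    have t3 := M.dist_triangle i y w
    rw [M.dist_comm y w] at t1
    rw [M.dist_comm i y, M.dist_comm y w] at t3
    linarith

end GeodesicModel

/-! ### A simplex around the origin -/

section Simplex

variable {d : ℕ}

lemma abs_apply_le_norm (v : EuclideanSpace ℝ (Fin d)) (i : Fin d) : |v i| ≤ ‖v‖ := by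
  simpa using PiLp.norm_apply_le v i

lemma opNorm_le_sum_abs (f : EuclideanSpace ℝ (Fin d) →L[ℝ] ℝ) :
    ‖f‖ ≤ ∑ i, |f (EuclideanSpace.single i 1)| := by
  refine f.opNorm_le_bound (Finset.sum_nonneg fun i _ => abs_nonneg _) fun v => ?_
  have hv : v = ∑ i, v i • EuclideanSpace.single i (1 : ℝ) := by
    have := (EuclideanSpace.basisFun (Fin d) ℝ).sum_repr v
    simpa using this.symm
  calc ‖f v‖ = |∑ i, v i * f (EuclideanSpace.single i 1)| := by
        conv_lhs => rw [hv]
        simp only [map_sum, map_smul, smul_eq_mul, Real.norm_eq_abs]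
    _ ≤ ∑ i, |v i * f (EuclideanSpace.single i 1)| := Finset.abs_sum_le_sum_abs _ _
    _ ≤ ∑ i, |f (EuclideanSpace.single i 1)| * ‖v‖ := by
        refine Finset.sum_le_sum fun i _ => ?_
        rw [abs_mul, mul_comm]
        exact mul_le_mul_of_nonneg_left (abs_apply_le_norm v i) (abs_nonneg _)
    _ = _ := (Finset.sum_mul _ _ _).symm

/-- The vertices `a e_i` and `-10 a (e_1 + ... + e_d)` of a simplex around `0`, together with
`0` itself. -/
def vertex (a : ℝ) : Option (Option (Fin d)) → EuclideanSpace ℝ (Fin d)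
  | none => 0
  | some none => (-(10 * a)) • ∑ i, EuclideanSpace.single i 1
  | some (some i) => a • EuclideanSpace.single i 1

/-- A point near `0` lies in the convex hull of any points near the vertices of the simplex: a
linear functional that separates it from these points would be small on each basis vector. -/
lemma mem_convexHull_of_near_vertex {a δ : ℝ} (hδ : 0 < δ) (ha : 4 * d ^ 2 * δ ≤ a) (ha0 : 0 < a)
    (y : Option (Option (Fin d)) → EuclideanSpace ℝ (Fin d))
    (hy : ∀ j, ‖y j - vertex a j‖ ≤ δ) :
    y none ∈ convexHull ℝ (Set.range fun j => y (some j)) := by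
  by_contra hx
  have hclosed : IsClosed (convexHull ℝ (Set.range fun j => y (some j))) :=
    (Set.finite_range _).isClosed_convexHull ℝ
  obtain ⟨f, u, hfx, hfu⟩ := geometric_hahn_banach_point_closed (convex_convexHull ℝ _) hclosed hx
  have hlt : ∀ j, f (y none) < f (y (some j)) := fun j =>
    hfx.trans (hfu _ (subset_convexHull ℝ _ ⟨j, rfl⟩))
  have herr : ∀ j, |f (y j - vertex a j)| ≤ ‖f‖ * δ := fun j =>
    (f.le_opNorm _).trans (mul_le_mul_of_nonneg_left (hy j) (norm_nonneg f))
  -- the functional is almost nonnegative on the vertices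
  have hvert : ∀ j, -(2 * (‖f‖ * δ)) < f (vertex a (some j)) := by
    intro j
    have h1 := (abs_le.1 (herr none)).1
    have h2 := (abs_le.1 (herr (some j))).2
    rw [map_sub] at h1 h2
    have h3 : f (vertex a none) = 0 := map_zero f
    have := hlt j
    linarith
  set M := ‖f‖
  set c : Fin d → ℝ := fun i => f (EuclideanSpace.single i 1)
  have hc : ∀ i, -(2 * (M * δ)) < a * c i := fun i => by
    have := hvert (some i)
    simpa only [vertex, map_smul, smul_eq_mul] using this
  have hsum : a * ∑ i, c i < 2 * (M * δ) := by
    have := hvert none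
    simp only [vertex, map_smul, smul_eq_mul, map_sum] at this
    have hM : 0 ≤ M * δ := by positivity
    change -(2 * (M * δ)) < -(10 * a) * ∑ i, c i at this
    linarith
  -- its values on the basis vectors are almost nonnegative and have an almost nonpositive sum
  have hupper : ∀ i, a * c i ≤ d * (2 * (M * δ)) := by
    intro i
    have h1 : ∑ j, a * c j = a * c i + ∑ j ∈ Finset.univ.erase i, a * c j :=
      (Finset.add_sum_erase _ _ (Finset.mem_univ i)).symm
    have h2 : ∑ _j ∈ Finset.univ.erase i, -(2 * (M * δ)) ≤ ∑ j ∈ Finset.univ.erase i, a * c j :=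
      Finset.sum_le_sum fun j _ => (hc j).le
    rw [Finset.sum_const, Finset.card_erase_of_mem (Finset.mem_univ i), Finset.card_univ,
      Fintype.card_fin, nsmul_eq_mul, Nat.cast_sub (Nat.one_le_of_lt i.2)] at h2
    rw [← Finset.mul_sum] at h1
    push_cast at h2
    linarith
  have habs : ∀ i, a * |c i| ≤ d * (2 * (M * δ)) := by
    intro i
    have hd : (1 : ℝ) ≤ d := by exact_mod_cast Nat.one_le_of_lt i.2
    have hM : 0 ≤ M * δ := by positivity
    rw [← abs_of_pos ha0, ← abs_mul, abs_le]
    refine ⟨?_, hupper i⟩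
    have := hc i
    nlinarith
  have hM : a * M ≤ d * (d * (2 * (M * δ))) := by
    calc a * M ≤ a * ∑ i, |c i| := mul_le_mul_of_nonneg_left (opNorm_le_sum_abs f) ha0.le
      _ = ∑ i, a * |c i| := Finset.mul_sum _ _ _
      _ ≤ ∑ _i : Fin d, d * (2 * (M * δ)) := Finset.sum_le_sum fun i _ => habs i
      _ = _ := by simp
  have hM0 : M = 0 := by
    have h0 : 0 ≤ M := norm_nonneg f
    nlinarith
  have hf0 : f = 0 := norm_eq_zero.1 hM0
  have := hlt none
  simp [hf0] at this

lemma vertex_some_none_apply (a : ℝ) (j : Fin d) : vertex a (some none) j = -(10 * a) := by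
  simp [vertex]

lemma vertex_some_some_apply (a : ℝ) (i j : Fin d) :
    vertex a (some (some i)) j = if j = i then a else 0 := by
  simp [vertex]

/-- Distinct vertices have distance at least `a`. -/
lemma le_dist_vertex {a : ℝ} (ha : 0 ≤ a) (hd : 1 ≤ d) {i j : Option (Option (Fin d))}
    (hij : i ≠ j) : a ≤ dist (vertex a i) (vertex a j) := by
  have key : ∀ l : Fin d, a ≤ |vertex a i l - vertex a j l| →
      a ≤ dist (vertex a i) (vertex a j) := fun l h => by
    rw [dist_eq_norm]
    exact h.trans (abs_apply_le_norm (vertex a i - vertex a j) l)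
  have h0 : ∀ l : Fin d, vertex a none l = 0 := fun l => rfl
  have hle : a ≤ |a| := le_abs_self a
  rcases i with _ | _ | i <;> rcases j with _ | _ | j
  · exact absurd rfl hij
  · refine key ⟨0, hd⟩ ?_
    rw [h0, vertex_some_none_apply, zero_sub, neg_neg]
    exact le_trans (by linarith) (le_abs_self _)
  · refine key j ?_
    rw [h0, vertex_some_some_apply, if_pos rfl, zero_sub, abs_neg]
    exact hle
  · refine key ⟨0, hd⟩ ?_
    rw [h0, vertex_some_none_apply, sub_zero, abs_neg]
    exact le_trans (by linarith) (le_abs_self _)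
  · exact absurd rfl hij
  · refine key j ?_
    rw [vertex_some_none_apply, vertex_some_some_apply, if_pos rfl]
    refine le_trans ?_ (neg_le_abs _)
    linarith
  · refine key i ?_
    rw [h0, vertex_some_some_apply, if_pos rfl, sub_zero]
    exact hle
  · refine key i ?_
    rw [vertex_some_none_apply, vertex_some_some_apply, if_pos rfl]
    refine le_trans ?_ (le_abs_self _)
    linarith
  · have hne : i ≠ j := fun h => hij (by rw [h])
    refine key i ?_
    rw [vertex_some_some_apply, vertex_some_some_apply, if_pos rfl, if_neg hne, sub_zero]
    exact hle

lemma norm_vertex_some_some {a : ℝ} (ha : 0 ≤ a) (i : Fin d) :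
    ‖vertex a (some (some i))‖ = a := by
  simp [vertex, norm_smul, abs_of_nonneg ha]

lemma norm_vertex_some_none_le {a : ℝ} (ha : 0 ≤ a) :
    ‖vertex (d := d) a (some none)‖ ≤ 10 * a * d := by
  rw [vertex, norm_smul, norm_neg, Real.norm_of_nonneg (by positivity)]
  refine mul_le_mul_of_nonneg_left ?_ (by positivity)
  refine (norm_sum_le _ _).trans ?_
  simp

lemma le_norm_vertex_some_none {a : ℝ} (hd : 1 ≤ d) :
    10 * a ≤ ‖vertex (d := d) a (some none)‖ := by
  refine le_trans ?_ (abs_apply_le_norm _ ⟨0, hd⟩)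
  rw [vertex_some_none_apply, abs_neg]
  exact le_abs_self _

end Simplex

/-! ### A point of prescribed outdegree -/

/-- The length `a` of the short edges from the centre in the simplex of the gadget, so small that the
gadget is contained in the unit ball. -/
def gadgetScale (d : ℕ) : ℝ := 1 / (100 * d)

/-- The radius of the regions around the vertices of the simplex in the gadget, as allowed by
`mem_convexHull_of_near_vertex`. -/
def gadgetRadius (d : ℕ) : ℝ := gadgetScale d / (4 * d ^ 2)

lemma gadgetScale_pos {d : ℕ} (hd : 1 ≤ d) : 0 < gadgetScale d := by
  have : (0 : ℝ) < d := by exact_mod_cast hd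
  unfold gadgetScale; positivity

lemma gadgetRadius_pos {d : ℕ} (hd : 1 ≤ d) : 0 < gadgetRadius d := by
  have : (0 : ℝ) < d := by exact_mod_cast hd
  have := gadgetScale_pos hd
  unfold gadgetRadius; positivity

lemma gadgetScale_mul {d : ℕ} (hd : 1 ≤ d) : gadgetScale d * d = 1 / 100 := by
  have : (0 : ℝ) < d := by exact_mod_cast hd
  unfold gadgetScale; field_simp

lemma gadgetScale_le {d : ℕ} (hd : 1 ≤ d) : gadgetScale d ≤ 1 / 100 := by
  have h1 : (1 : ℝ) ≤ d := by exact_mod_cast hd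
  nlinarith [gadgetScale_pos hd, gadgetScale_mul hd]

lemma sq_mul_gadgetRadius {d : ℕ} (hd : 1 ≤ d) : 4 * d ^ 2 * gadgetRadius d = gadgetScale d := by
  have : (0 : ℝ) < d := by exact_mod_cast hd
  unfold gadgetRadius; field_simp

lemma mul_gadgetRadius_le {d : ℕ} (hd : 1 ≤ d) : 4 * d * gadgetRadius d ≤ gadgetScale d := by
  have h1 : (1 : ℝ) ≤ d := by exact_mod_cast hd
  have h2 := gadgetRadius_pos hd
  rw [← sq_mul_gadgetRadius hd]
  have : (d : ℝ) ≤ d ^ 2 := by nlinarith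
  nlinarith

lemma four_mul_gadgetRadius_le {d : ℕ} (hd : 1 ≤ d) : 4 * gadgetRadius d ≤ gadgetScale d := by
  have h1 : (1 : ℝ) ≤ d := by exact_mod_cast hd
  have h2 := gadgetRadius_pos hd
  have := mul_gadgetRadius_le hd
  nlinarith

lemma norm_vertex_le {d : ℕ} (hd : 1 ≤ d) (j : Option (Option (Fin d))) :
    ‖vertex (gadgetScale d) j‖ ≤ 1 / 10 := by
  have h1 := gadgetScale_le hd
  have h2 := gadgetScale_pos hd
  have h3 := gadgetScale_mul hd
  rcases j with _ | _ | i
  · simp [vertex]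
  · refine (norm_vertex_some_none_le h2.le).trans ?_
    linarith
  · rw [norm_vertex_some_some h2.le]; linarith

/-- The number of points of the gadget near each vertex: one point near the centre, and `k` points
near the vertices of the simplex, with the excess near the first vertex. -/
def gadgetCount {d : ℕ} (hd : 1 ≤ d) (k : ℕ) : Option (Option (Fin d)) → ℕ
  | none => 1
  | some none => 1
  | some (some i) => if i = ⟨0, hd⟩ then k - d else 1

lemma sum_gadgetCount {d k : ℕ} (hd : 1 ≤ d) (hk : d + 1 ≤ k) :
    ∑ j : Option (Fin d), gadgetCount hd k (some j) = k := by
  rw [Fintype.sum_option]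
  simp only [gadgetCount]
  rw [Finset.sum_ite, Finset.sum_const, Finset.sum_const, Finset.filter_eq' Finset.univ,
    Finset.filter_ne', if_pos (Finset.mem_univ _), Finset.card_singleton,
    Finset.card_erase_of_mem (Finset.mem_univ _), Finset.card_univ, Fintype.card_fin]
  simp only [smul_eq_mul]
  omega

lemma gadgetCount_pos {d k : ℕ} (hd : 1 ≤ d) (hk : d + 1 ≤ k) (j : Option (Option (Fin d))) :
    1 ≤ gadgetCount hd k j := by
  rcases j with _ | _ | i
  · exact le_rfl
  · exact le_rfl
  · rw [gadgetCount]
    split_ifs <;> omega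

namespace GeodesicModel

variable {d : ℕ} {X : Type*} [Dist X] [MeasureSpace X] (M : GeodesicModel d X)

include M

/-- The region of the gadget around a vertex. -/
def region (j : Option (Option (Fin d))) : Set X :=
  M.chart ⁻¹' Metric.ball (vertex (gadgetScale d) j) (gadgetRadius d)

lemma measurableSet_region (j : Option (Option (Fin d))) : MeasurableSet (M.region j) :=
  M.measurable_chart Metric.isOpen_ball.measurableSet

lemma disjoint_region (hd : 1 ≤ d) {i j : Option (Option (Fin d))} (hij : i ≠ j) :
    Disjoint (M.region i) (M.region j) := by
  refine Disjoint.preimage _ (Metric.ball_disjoint_ball ?_)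
  have h1 := le_dist_vertex (gadgetScale_pos hd).le hd hij
  have h2 := four_mul_gadgetRadius_le hd
  have h3 := gadgetRadius_pos hd
  linarith

lemma norm_chart_sub_lt {j : Option (Option (Fin d))} {x : X} (hx : x ∈ M.region j) :
    ‖M.chart x - vertex (gadgetScale d) j‖ < gadgetRadius d := by
  rw [← dist_eq_norm]; exact hx

lemma dist_origin_le_of_mem_region (hd : 1 ≤ d) {j : Option (Option (Fin d))} {x : X}
    (hx : x ∈ M.region j) {r : ℝ} (hr : ‖vertex (gadgetScale d) j‖ ≤ r) (hr' : r ≤ 1 / 10) :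
    dist M.origin x ≤ 2 * (r + gadgetRadius d) := by
  have h1 := M.norm_chart_sub_lt hx
  have h2 : ‖M.chart x‖ ≤ r + gadgetRadius d := by
    have := norm_le_norm_add_norm_sub (vertex (gadgetScale d) j) (M.chart x)
    rw [norm_sub_rev] at this
    have h3 := norm_sub_rev (M.chart x) (vertex (gadgetScale d) j)
    linarith
  have h3 := gadgetScale_le hd
  have h4 := four_mul_gadgetRadius_le hd
  have := M.dist_le x (by linarith)
  linarith

lemma region_subset (hd : 1 ≤ d) (j : Option (Option (Fin d))) :
    M.region j ⊆ cball M.origin 1 := fun x hx => by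
  have h1 := M.dist_origin_le_of_mem_region hd hx (norm_vertex_le hd j) le_rfl
  have h3 := gadgetScale_le hd
  have h4 := four_mul_gadgetRadius_le hd
  change dist M.origin x ≤ 1
  linarith

lemma volume_region_pos (hd : 1 ≤ d) (j : Option (Option (Fin d))) :
    0 < volume (M.region j) := by
  refine M.volume_preimage_pos _ Metric.isOpen_ball
    ⟨vertex (gadgetScale d) j, Metric.mem_ball_self (gadgetRadius_pos hd),
      M.ball_subset_range ?_⟩
  rw [mem_ball_zero_iff]
  have := norm_vertex_le hd j
  linarith

/-- In the gadget, the point near the centre of the simplex has outdegree `k`: its `k` nearest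
neighbours are the points near the vertices, the farthest of them is the one near the vertex
`-10 a (1, ..., 1)`, and the others lie in a half-space that does not contain the centre. -/
lemma exists_outdeg_eq (hd : 1 ≤ d) {k : ℕ} (hk : d + 1 ≤ k) {S : Set X}
    (hreg : ∀ j, (S ∩ M.region j).encard = gadgetCount hd k j)
    (hrest : (S ∩ (cball M.origin 1 \ ⋃ j, M.region j)).encard = 0) :
    ∃ x ∈ S ∩ cball M.origin 1, outdeg x S = k := by
  have hne : ∀ j, ∃ y, y ∈ S ∩ M.region j := fun j => by
    rw [← Set.Nonempty, ← Set.encard_pos, hreg]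
    exact_mod_cast gadgetCount_pos hd hk j
  choose y hy using hne
  set a := gadgetScale d with ha
  set δ := gadgetRadius d with hδ
  have ha0 : 0 < a := gadgetScale_pos hd
  have ha1 : a ≤ 1 / 100 := gadgetScale_le hd
  have hδ0 : 0 < δ := gadgetRadius_pos hd
  have hδa : 4 * δ ≤ a := four_mul_gadgetRadius_le hd
  set x := y none with hx
  have hxo : dist M.origin x ≤ 2 * δ := by
    have := M.dist_origin_le_of_mem_region hd (hy none).2 (r := 0) (by simp [vertex]) (by norm_num)
    simpa using this
  -- the only point near the centre
  have hsingle : S ∩ M.region none = {x} := by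
    obtain ⟨z, hz⟩ := Set.encard_eq_one.1 ((hreg none).trans Nat.cast_one)
    have : x ∈ S ∩ M.region none := hy none
    rw [hz, Set.mem_singleton_iff] at this
    rw [hz, this]
  have hsingle' : S ∩ M.region (some none) = {y (some none)} := by
    obtain ⟨z, hz⟩ := Set.encard_eq_one.1 ((hreg (some none)).trans Nat.cast_one)
    have : y (some none) ∈ S ∩ M.region (some none) := hy (some none)
    rw [hz, Set.mem_singleton_iff] at this
    rw [hz, this]
  set W := ⋃ j : Option (Fin d), S ∩ M.region (some j) with hW
  have hWcard : W.encard = k := by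
    rw [hW, Set.encard_iUnion_of_finite, finsum_eq_sum_of_fintype]
    · simp only [hreg]
      rw [← Nat.cast_sum, sum_gadgetCount hd hk]
    · intro i j hij
      exact (M.disjoint_region hd fun h => hij (Option.some_injective _ h)).mono
        Set.inter_subset_right Set.inter_subset_right
  have hWx : ∀ z ∈ W, z ≠ x := by
    rintro z hz rfl
    obtain ⟨j, hj⟩ := Set.mem_iUnion.1 hz
    exact Set.disjoint_left.1 (M.disjoint_region hd (Option.some_ne_none j)) hj.2 (hy none).2
  have hWmem : ∀ z ∈ S, z ≠ x → z ∈ cball M.origin 1 → z ∈ W := by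
    intro z hzS hzx hz
    rw [Set.encard_eq_zero] at hrest
    have : ∃ j, z ∈ M.region j := by
      by_contra hno
      have : z ∈ S ∩ (cball M.origin 1 \ ⋃ j, M.region j) :=
        ⟨hzS, hz, fun h => hno (Set.mem_iUnion.1 h)⟩
      rw [hrest] at this
      exact this
    obtain ⟨j, hj⟩ := this
    rcases j with _ | j
    · have : z ∈ S ∩ M.region none := ⟨hzS, hj⟩
      rw [hsingle] at this
      exact absurd this hzx
    · exact Set.mem_iUnion.2 ⟨j, hzS, hj⟩
  -- distances from the centre
  have hfar : ∀ z ∈ W, dist x z ≤ dist x (y (some none)) := by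
    intro z hz
    obtain ⟨j, hzS, hj⟩ := Set.mem_iUnion.1 hz
    rcases j with _ | i
    · have : z ∈ S ∩ M.region (some none) := ⟨hzS, hj⟩
      rw [hsingle'] at this
      rw [this]
    · have h1 := M.dist_origin_le_of_mem_region hd hj (r := a)
        (norm_vertex_some_some ha0.le i).le (by linarith)
      have h2 := M.norm_chart_le (y (some none))
      have h3 := M.norm_chart_sub_lt (hy (some none)).2
      have h4 := le_norm_vertex_some_none (a := a) hd
      have h5 := norm_le_norm_add_norm_sub (M.chart (y (some none))) (vertex a (some none))
      have t1 := M.dist_triangle x M.origin z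
      have t2 := M.dist_triangle M.origin x (y (some none))
      rw [M.dist_comm x M.origin] at t1
      linarith
  have hnear : ∀ z ∈ W, ∀ w, w ∉ cball M.origin 1 → dist x z < dist x w := by
    intro z hz w hw
    obtain ⟨j, -, hj⟩ := Set.mem_iUnion.1 hz
    have h1 := M.dist_origin_le_of_mem_region hd hj (norm_vertex_le hd _) le_rfl
    have h2 : 1 < dist M.origin w := not_le.1 hw
    have t1 := M.dist_triangle x M.origin z
    have t2 := M.dist_triangle M.origin x w
    rw [M.dist_comm x M.origin] at t1
    linarith
  have hxW : x ∈ convHull W := by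
    rw [M.mem_convHull_iff]
    have h1 := mem_convexHull_of_near_vertex (d := d) hδ0 (sq_mul_gadgetRadius hd).le ha0
      (fun j => M.chart (y j)) (fun j => (M.norm_chart_sub_lt (hy j).2).le)
    refine convexHull_mono ?_ h1
    rintro _ ⟨j, rfl⟩
    exact ⟨y (some j), Set.mem_iUnion.2 ⟨j, hy (some j)⟩, rfl⟩
  -- a half-space that contains all neighbours but the farthest
  have hhalf : x ∉ convHull {z | ∃ i : Fin d, z ∈ M.region (some (some i))} := by
    intro hmem
    have hconv : Convex ℝ {q : EuclideanSpace ℝ (Fin d) |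
        ∑ i, M.chart x i < ∑ i, q i} := by
      refine convex_halfSpace_gt ⟨fun u v => ?_, fun c u => ?_⟩ _
      · simp [Finset.sum_add_distrib]
      · simp [Finset.mul_sum]
    have hle : ∀ v : EuclideanSpace ℝ (Fin d), |∑ i, v i| ≤ d * ‖v‖ := fun v => by
      refine (Finset.abs_sum_le_sum_abs _ _).trans ?_
      refine (Finset.sum_le_sum fun i _ => abs_apply_le_norm v i).trans (le_of_eq ?_)
      simp
    have hsub := hmem _ ⟨?_, M.geodConvex_preimage hconv⟩
    · exact lt_irrefl _ (show ∑ i, M.chart x i < ∑ i, M.chart x i from hsub)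
    · rintro z ⟨i, hz⟩
      change ∑ j, M.chart x j < ∑ j, M.chart z j
      have h1 := M.norm_chart_sub_lt hz
      have h2 := M.norm_chart_sub_lt (hy none).2
      have h3 := hle (M.chart z - vertex a (some (some i)))
      have h4 := hle (M.chart x - vertex a none)
      have h5 : ∑ j, (M.chart z - vertex a (some (some i))) j = ∑ j, M.chart z j - a := by
        simp [vertex_some_some_apply]
      have h6 : ∑ j, (M.chart x - vertex a none : EuclideanSpace ℝ (Fin d)) j = ∑ j, M.chart x j := by
        simp [vertex]
      rw [h5] at h3
      rw [h6] at h4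
      have h7 := mul_gadgetRadius_le hd
      have hd0 : (0 : ℝ) < d := by exact_mod_cast hd
      have h8 := mul_lt_mul_of_pos_left h1 hd0
      have h9 := mul_lt_mul_of_pos_left h2 hd0
      have h10 := (abs_le.1 h3).1
      have h11 := (abs_le.1 h4).2
      linarith
  refine ⟨x, ⟨(hy none).1, M.region_subset hd none (hy none).2⟩, ?_⟩
  rw [outdeg, ← hWcard]
  congr 1
  ext w
  constructor
  · rintro ⟨hwS, hwx, hw⟩
    refine hWmem w hwS hwx ?_
    by_contra hwI
    refine hw (convHull_mono ?_ hxW)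
    intro z hz
    obtain ⟨j, hj⟩ := Set.mem_iUnion.1 hz
    exact ⟨hj.1, hWx z hz, hnear z hz w hwI⟩
  · intro hw
    obtain ⟨j, hj⟩ := Set.mem_iUnion.1 hw
    refine ⟨hj.1, hWx w hw, fun hmem => hhalf (convHull_mono ?_ hmem)⟩
    rintro z ⟨hzS, hzx, hz⟩
    have hzW : z ∈ W := by
      refine hWmem z hzS hzx ?_
      by_contra hzI
      exact absurd (hnear w hw z hzI) (not_lt.2 hz.le)
    obtain ⟨l, hl⟩ := Set.mem_iUnion.1 hzW
    rcases l with _ | i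
    · exfalso
      rw [hsingle'] at hl
      rw [hl] at hz
      exact absurd (hfar w hw) (not_le.2 hz)
    · exact ⟨i, hl.2⟩

end GeodesicModel

/-! ### Events on finitely many counts -/

section CountEvents

variable {X : Type*} {ι : Type*}

/-- The event that the numbers of points in the sets `A i` lie in `T i`. -/
def countEvent (A : ι → Set X) (T : ι → Set ℕ∞) : Set (Config X) :=
  {S | ∀ i, (S.points ∩ A i).encard ∈ T i}

lemma inter_mem_countEvent_iff {A : ι → Set X} {B : Set X} (hAB : ∀ i, A i ⊆ B)
    (T : ι → Set ℕ∞) (S : Config X) :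
    Config.mk (S.points ∩ B) ∈ countEvent A T ↔ S ∈ countEvent A T := by
  have : ∀ i, S.points ∩ B ∩ A i = S.points ∩ A i := fun i => by
    rw [Set.inter_assoc, Set.inter_eq_right.2 (hAB i)]
  simp only [countEvent, Set.mem_ofPred_eq, this]

variable [MeasurableSpace X]

lemma measurableSet_countEvent [Countable ι] {A : ι → Set X} (hA : ∀ i, MeasurableSet (A i))
    (T : ι → Set ℕ∞) : MeasurableSet (countEvent A T) := by
  have : countEvent A T = ⋂ i, (fun S : Config X => (S.points ∩ A i).encard) ⁻¹' T i := by
    ext S; simp [countEvent]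
  rw [this]
  exact MeasurableSet.iInter fun i => Config.measurable_encard (hA i) MeasurableSet.of_discrete

/-- The probability of a count event under a Poisson process with intensity measure `μ`. -/
def countProb [Fintype ι] (μ : Measure X) (A : ι → Set X) (T : ι → Set ℕ∞) : ℝ :=
  (∏ i, poissonMeasure (μ (A i)).toNNReal ((fun n : ℕ => (n : ℕ∞)) ⁻¹' T i)).toReal

lemma countProb_pos [Fintype ι] {μ : Measure X} {A : ι → Set X} {T : ι → Set ℕ∞} (n : ι → ℕ)
    (hn : ∀ i, (n i : ℕ∞) ∈ T i) (hfin : ∀ i, μ (A i) ≠ ⊤)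
    (hpos : ∀ i, n i = 0 ∨ 0 < μ (A i)) : 0 < countProb μ A T := by
  refine ENNReal.toReal_pos (Finset.prod_ne_zero_iff.2 fun i _ => ?_)
    (ENNReal.prod_ne_top fun i _ => measure_ne_top _ _)
  have hle : poissonMeasure (μ (A i)).toNNReal {n i}
      ≤ poissonMeasure (μ (A i)).toNNReal ((fun n : ℕ => (n : ℕ∞)) ⁻¹' T i) :=
    measure_mono (by simpa using hn i)
  refine ((pos_iff_ne_zero.2 ?_).trans_le hle).ne'
  rw [poissonMeasure_singleton]
  refine (ENNReal.ofReal_pos.2 ?_).ne'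
  rcases hpos i with h | h
  · rw [h, pow_zero]; positivity
  · have : 0 < (μ (A i)).toNNReal := ENNReal.toNNReal_pos h.ne' (hfin i)
    positivity

lemma IsPoissonProcess.measureReal_countEvent [Fintype ι] {Ω : Type*} [MeasurableSpace Ω]
    {P : Measure Ω} {η : Ω → Set X} {μ : Measure X} (h : IsPoissonProcess η P μ)
    {A : ι → Set X} (hA : ∀ i, MeasurableSet (A i))
    (hd : Pairwise (Function.onFun Disjoint A)) (hfin : ∀ i, μ (A i) ≠ ⊤) (T : ι → Set ℕ∞) :
    P.real {ω | Config.mk (η ω) ∈ countEvent A T} = countProb μ A T := by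
  rw [measureReal_def, countProb, ← h.measure_forall_encard A hA hd hfin]
  rfl

end CountEvents

/-! ### A lower bound for the variance -/

/-- If `G` has covariance at least `q` with each of finitely many centred, pairwise uncorrelated
random variables of second moment at most `1`, then its variance is at least `q ^ 2` times their
number. -/
lemma mul_card_le_variance {Ω ι : Type*} [MeasurableSpace Ω] {P : Measure Ω}
    [IsProbabilityMeasure P] {G : Ω → ℝ} (hG : MemLp G 2 P) (s : Finset ι) {h : ι → Ω → ℝ}
    (hh : ∀ i ∈ s, MemLp (h i) 2 P) (h0 : ∀ i ∈ s, ∫ ω, h i ω ∂P = 0)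
    (h1 : ∀ i ∈ s, ∫ ω, h i ω * h i ω ∂P ≤ 1)
    (hij : ∀ i ∈ s, ∀ j ∈ s, i ≠ j → ∫ ω, h i ω * h j ω ∂P = 0) {q : ℝ} (hq : 0 ≤ q)
    (hGh : ∀ i ∈ s, q ≤ ∫ ω, G ω * h i ω ∂P) :
    q ^ 2 * s.card ≤ variance G P := by
  have hint : ∀ {f g : Ω → ℝ}, MemLp f 2 P → MemLp g 2 P →
      Integrable (fun ω => f ω * g ω) P := fun hf hg => hf.integrable_mul hg
  set m := ∫ ω, G ω ∂P with hm
  set Y : Ω → ℝ := fun ω => G ω - m with hY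
  set H : Ω → ℝ := fun ω => ∑ i ∈ s, h i ω with hH
  have hYm : MemLp Y 2 P := hG.sub (memLp_const m)
  have hHm : MemLp H 2 P := memLp_finsetSum s hh
  have hYH : (s.card : ℝ) * q ≤ ∫ ω, Y ω * H ω ∂P := by
    have e1 : ∀ ω, Y ω * H ω = ∑ i ∈ s, Y ω * h i ω := fun ω => Finset.mul_sum _ _ _
    simp only [e1]
    rw [integral_finsetSum s fun i hi => hint hYm (hh i hi), ← nsmul_eq_mul,
      ← Finset.sum_const]
    refine Finset.sum_le_sum fun i hi => ?_
    have e2 : ∫ ω, Y ω * h i ω ∂P = ∫ ω, G ω * h i ω ∂P - m * ∫ ω, h i ω ∂P := by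
      rw [← integral_const_mul, ← integral_sub (hint hG (hh i hi))
        (((hh i hi).integrable (by norm_num)).const_mul m)]
      refine integral_congr_ae (Filter.Eventually.of_forall fun ω => ?_)
      simp only [hY]
      ring
    rw [e2, h0 i hi, mul_zero, sub_zero]
    exact hGh i hi
  have hHH : ∫ ω, H ω * H ω ∂P ≤ s.card := by
    have e1 : ∀ ω, H ω * H ω = ∑ i ∈ s, ∑ j ∈ s, h i ω * h j ω := fun ω =>
      Finset.sum_mul_sum _ _ _ _
    simp only [e1]
    rw [integral_finsetSum s fun i hi =>
      integrable_finsetSum s fun j hj => hint (hh i hi) (hh j hj)]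
    calc ∑ i ∈ s, ∫ ω, ∑ j ∈ s, h i ω * h j ω ∂P ≤ ∑ i ∈ s, 1 := by
          refine Finset.sum_le_sum fun i hi => ?_
          rw [integral_finsetSum s fun j hj => hint (hh i hi) (hh j hj),
            Finset.sum_eq_single_of_mem i hi fun j hj hne => hij i hi j hj hne.symm]
          exact h1 i hi
      _ = s.card := by simp
  have hexp : ∫ ω, (Y ω - q * H ω) ^ 2 ∂P
      = ∫ ω, Y ω ^ 2 ∂P - 2 * q * ∫ ω, Y ω * H ω ∂P + q ^ 2 * ∫ ω, H ω * H ω ∂P := by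
    have hsub : Integrable (fun ω => Y ω ^ 2 - 2 * q * (Y ω * H ω)) P :=
      hYm.integrable_sq.sub ((hint hYm hHm).const_mul _)
    rw [← integral_const_mul, ← integral_const_mul, ← integral_sub hYm.integrable_sq
      ((hint hYm hHm).const_mul _), ← integral_add hsub ((hint hHm hHm).const_mul _)]
    refine integral_congr_ae (Filter.Eventually.of_forall fun ω => ?_)
    ring
  have hvar : variance G P = ∫ ω, Y ω ^ 2 ∂P := variance_eq_integral hG.aemeasurable
  have hnn : 0 ≤ ∫ ω, (Y ω - q * H ω) ^ 2 ∂P := integral_nonneg fun ω => sq_nonneg _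
  rw [hvar]
  have h2 := mul_le_mul_of_nonneg_left hYH (by positivity : 0 ≤ 2 * q)
  have h3 := mul_le_mul_of_nonneg_left hHH (by positivity : 0 ≤ q ^ 2)
  nlinarith

/-! ### Isometries -/

section Isometries

variable {X : Type*} [Dist X]

lemma GeodConvex.preimage {C : Set X} (hC : GeodConvex C) {f : X → X}
    (hf : ∀ x y, dist (f x) (f y) = dist x y) : GeodConvex (f ⁻¹' C) := fun x hx y hy z h =>
  hC _ hx _ hy _ (by rw [hf, hf, hf]; exact h)

lemma apply_mem_convHull {S : Set X} {x : X} (hx : x ∈ convHull S) {f : X → X}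
    (hf : ∀ x y, dist (f x) (f y) = dist x y) : f x ∈ convHull (f '' S) := fun C hC =>
  hx (f ⁻¹' C) ⟨fun _ hy => hC.1 ⟨_, hy, rfl⟩, hC.2.preimage hf⟩

lemma apply_mem_convHull_iff {S : Set X} {x : X} (e : X ≃ X)
    (he : ∀ x y, dist (e x) (e y) = dist x y) : e x ∈ convHull (e '' S) ↔ x ∈ convHull S := by
  refine ⟨fun h => ?_, fun h => apply_mem_convHull h he⟩
  have := apply_mem_convHull h (f := e.symm) fun x y => by rw [← he]; simp
  simpa [Set.image_image] using this

lemma outdeg_image (S : Set X) (x : X) (e : X ≃ X)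
    (he : ∀ x y, dist (e x) (e y) = dist x y) : outdeg (e x) (e '' S) = outdeg x S := by
  rw [outdeg, outdeg, ← e.injective.encard_image (outNeighbours x S)]
  congr 1
  ext y
  obtain ⟨y, rfl⟩ := e.surjective y
  have hcl : {z | z ∈ e '' S ∧ z ≠ e x ∧ dist (e x) z < dist (e x) (e y)}
      = e '' {z | z ∈ S ∧ z ≠ x ∧ dist x z < dist x y} := by
    ext z
    obtain ⟨z, rfl⟩ := e.surjective z
    rw [e.injective.mem_set_image]
    simp only [Set.mem_ofPred_eq, e.injective.mem_set_image, he, e.injective.ne_iff]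
  rw [e.injective.mem_set_image]
  simp only [outNeighbours, Set.mem_ofPred_eq, hcl, apply_mem_convHull_iff e he,
    e.injective.mem_set_image, e.injective.ne_iff]

lemma outdegCount_image (k : ℕ) (p : X) (t : ℝ) (S : Set X) (e : X ≃ X)
    (he : ∀ x y, dist (e x) (e y) = dist x y) :
    outdegCount k (e p) t (e '' S) = outdegCount k p t S := by
  rw [outdegCount, outdegCount, ← Set.ncard_image_of_injective
    {x | x ∈ S ∧ x ∈ cball p t ∧ outdeg x S = k} e.injective]
  congr 2
  ext y
  obtain ⟨y, rfl⟩ := e.surjective y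
  rw [e.injective.mem_set_image]
  simp only [Set.mem_ofPred_eq, outdeg_image S _ e he, cball, he, e.injective.mem_set_image]

end Isometries

/-! ### Indicator functions of events -/

section Indicator

variable {X : Type*}

/-- The real-valued indicator function of an event. -/
def ind (E : Set (Config X)) : Config X → ℝ := E.indicator fun _ => 1

lemma ind_of_mem {E : Set (Config X)} {S : Config X} (h : S ∈ E) : ind E S = 1 :=
  Set.indicator_of_mem h _

lemma ind_of_notMem {E : Set (Config X)} {S : Config X} (h : S ∉ E) : ind E S = 0 :=
  Set.indicator_of_notMem h _

lemma ind_congr {E : Set (Config X)} {S S' : Config X} (h : S ∈ E ↔ S' ∈ E) :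
    ind E S = ind E S' := by
  by_cases hS : S ∈ E
  · rw [ind_of_mem hS, ind_of_mem (h.1 hS)]
  · rw [ind_of_notMem hS, ind_of_notMem fun h' => hS (h.2 h')]

lemma ind_eq_zero_or_one (E : Set (Config X)) (S : Config X) : ind E S = 0 ∨ ind E S = 1 := by
  by_cases hS : S ∈ E
  · exact Or.inr (ind_of_mem hS)
  · exact Or.inl (ind_of_notMem hS)

lemma abs_ind_le (E : Set (Config X)) (S : Config X) : |ind E S| ≤ 1 := by
  rcases ind_eq_zero_or_one E S with h | h <;> simp [h]

variable [MeasurableSpace X]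

lemma measurable_ind {E : Set (Config X)} (hE : MeasurableSet E) : Measurable (ind E) :=
  measurable_const.indicator hE

lemma IsPoissonProcess.integral_ind {Ω : Type*} [MeasurableSpace Ω] {P : Measure Ω}
    {η : Ω → Set X} {μ : Measure X} (h : IsPoissonProcess η P μ)
    {E : Set (Config X)} (hE : MeasurableSet E) :
    ∫ ω, ind E ⟨η ω⟩ ∂P = P.real {ω | Config.mk (η ω) ∈ E} := by
  have h1 : MeasurableSet {ω | Config.mk (η ω) ∈ E} := h.measurable hE
  rw [← integral_indicator_one h1]
  rfl

end Indicator

lemma memLp_of_abs_le_one {Ω : Type*} [MeasurableSpace Ω] {P : Measure Ω} [IsProbabilityMeasure P]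
    {f : Ω → ℝ} (hf : Measurable f) (h1 : ∀ ω, |f ω| ≤ 1) : MemLp f 2 P :=
  MemLp.of_bound hf.aestronglyMeasurable 1 (Filter.Eventually.of_forall h1)

namespace GeodesicModel

variable {d : ℕ} {X : Type*} [Dist X] [MeasureSpace X] (M : GeodesicModel d X)

include M

/-! ### The number of points of given outdegree of a Poisson process -/

section Poisson

variable {Ω : Type*} [MeasurableSpace Ω] {P : Measure Ω} {η : Ω → Set X}

lemma ae_locFinite (h : IsPoissonProcess η P volume) : ∀ᵐ ω ∂P, M.LocFinite (η ω) := by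
  simp only [LocFinite]
  rw [ae_all_iff]
  exact fun n => h.ae_encard_lt_top (M.measurableSet_cball _ _) (M.volume_cball_ne_top _ _)

/-- The number of points of outdegree `k` in a ball is square integrable. -/
lemma memLp_outdegCount [StandardBorelSpace X] (h : IsPoissonProcess η P volume)
    (k : ℕ) (p : X) (t : ℝ) : MemLp (fun ω => outdegCount k p t (η ω)) 2 P := by
  obtain ⟨g, hg, hgS⟩ := M.exists_measurable_outdegCount k p t
  have hN := h.memLp_encard (M.measurableSet_cball p t) (M.volume_cball_ne_top p t)
  refine hN.mono ?_ ?_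
  · refine (hg.comp h.measurable).aestronglyMeasurable.congr ?_
    filter_upwards [M.ae_locFinite h] with ω hω
    exact hgS _ hω
  · filter_upwards [M.ae_locFinite h] with ω hω
    have h0 : 0 ≤ outdegCount k p t (η ω) := Nat.cast_nonneg _
    rw [Real.norm_of_nonneg h0, Real.norm_of_nonneg (Nat.cast_nonneg _)]
    exact M.outdegCount_le hω k p t

end Poisson

/-! ### The effect of a local modification -/

variable {k : ℕ} (hd : 1 ≤ d) (F : Finset X)

/-- The regions of the gadget: those around the vertices of the simplex and the rest of the unit
ball. -/
def gadgetRegion : Option (Option (Option (Fin d))) → Set X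
  | none => cball M.origin 1 \ ⋃ j, M.region j
  | some j => M.region j

/-- The event that the unit ball contains exactly the points of the gadget. -/
def gadgetEvent (k : ℕ) : Set (Config X) :=
  countEvent M.gadgetRegion fun j => {((j.elim 0 (gadgetCount hd k) : ℕ) : ℕ∞)}

/-- The event that the unit ball contains no points. -/
def emptyEvent : Set (Config X) :=
  countEvent (fun _ : Unit => cball M.origin 1) fun _ => {0}

/-- The regions of the shield: balls around the points of `F`, and the buffer. -/
def shieldRegion : Option F → Set X
  | none => M.buffer F
  | some w => cball w.1 (1 / 3)

/-- The event that there is a cluster of points near each point of `F` and that there are no points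
in the buffer. -/
def shieldEvent (k : ℕ) : Set (Config X) :=
  countEvent (M.shieldRegion F) fun j => j.elim {0} fun _ => {n | ((k + 2 : ℕ) : ℕ∞) ≤ n}

lemma measurableSet_gadgetRegion (j) : MeasurableSet (M.gadgetRegion j) := by
  rcases j with _ | j
  · exact (M.measurableSet_cball _ _).diff (MeasurableSet.iUnion fun j => M.measurableSet_region j)
  · exact M.measurableSet_region j

include hd in
lemma gadgetRegion_subset (j) : M.gadgetRegion j ⊆ cball M.origin 1 := by
  rcases j with _ | j
  · exact Set.sdiff_subset
  · exact M.region_subset hd j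

lemma measurableSet_shieldRegion (j) : MeasurableSet (M.shieldRegion F j) := by
  rcases j with _ | j
  · exact M.measurableSet_buffer F
  · exact M.measurableSet_cball _ _

variable {F} in
lemma shieldRegion_subset_compl (hF : ∀ w ∈ F, dist M.origin w = 3) (j) :
    M.shieldRegion F j ⊆ (cball M.origin 1)ᶜ := by
  rcases j with _ | j
  · exact fun x hx hx1 => hx.2 (Or.inl hx1)
  · exact (M.disjoint_cball_one (hF j.1 j.2)).subset_compl_left

variable {F} in
lemma shieldRegion_subset (hF : ∀ w ∈ F, dist M.origin w = 3) (j) :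
    M.shieldRegion F j ⊆ cball M.origin 4 := by
  rcases j with _ | j
  · exact Set.sdiff_subset.trans (M.cball_subset_cball _ _ (by rw [M.dist_self]; norm_num))
  · exact M.cball_subset_cball _ _ (by rw [hF j.1 j.2]; norm_num)

/-- On the shield and gadget events, deleting the points in the unit ball lowers the number of
points of outdegree `k`. -/
lemma outdegCount_sdiff_add_one_le (hk : d + 1 ≤ k) (hF : ∀ w ∈ F, dist M.origin w = 3)
    (hnet : ∀ x, dist M.origin x = 3 → ∃ w ∈ F, dist w x ≤ 1) {S : Config X}
    (hS : M.LocFinite S.points) (hsh : S ∈ M.shieldEvent F k) (hgad : S ∈ M.gadgetEvent hd k)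
    {p : X} {t : ℝ} (hp : dist p M.origin ≤ t - 1) :
    outdegCount k p t (S.points ∩ (cball M.origin 1)ᶜ) + 1 ≤ outdegCount k p t S.points := by
  obtain ⟨x, hx, hxk⟩ := M.exists_outdeg_eq hd hk (S := S.points)
    (fun j => hgad (some j)) (hgad none)
  rw [← Set.sdiff_eq]
  refine M.outdegCount_add_one_le hS (fun y hy => ?_) hx ?_ hxk
  · exact M.shielded_of_clusters hF hnet (hsh none)
      (fun w hw => hsh (some ⟨w, hw⟩)) hy
  · exact M.cball_subset_cball _ _ (by linarith) hx.2

/-! ### The test function of a cell -/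

/-- The probability of the gadget event. -/
def gadgetProb (k : ℕ) : ℝ :=
  countProb volume M.gadgetRegion fun j => {((j.elim 0 (gadgetCount hd k) : ℕ) : ℕ∞)}

/-- The probability of the empty event. -/
def emptyProb : ℝ := countProb volume (fun _ : Unit => cball M.origin 1) fun _ => {0}

/-- The probability of the shield event. -/
def shieldProb (k : ℕ) : ℝ :=
  countProb volume (M.shieldRegion F) fun j => j.elim {0} fun _ => {n | ((k + 2 : ℕ) : ℕ∞) ≤ n}

/-- The test function of the cell at the origin: on the shield event it compares the gadget with the
empty unit ball, with weights that make it centred for a Poisson process. -/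
def testFun (k : ℕ) (S : Config X) : ℝ :=
  ind (M.shieldEvent F k) S *
    (M.emptyProb * ind (M.gadgetEvent hd k) S
      - M.gadgetProb hd k * ind M.emptyEvent S)

lemma measurableSet_gadgetEvent : MeasurableSet (M.gadgetEvent hd k) :=
  measurableSet_countEvent M.measurableSet_gadgetRegion _

lemma measurableSet_emptyEvent : MeasurableSet M.emptyEvent :=
  measurableSet_countEvent (fun _ => M.measurableSet_cball _ _) _

lemma measurableSet_shieldEvent : MeasurableSet (M.shieldEvent F k) :=
  measurableSet_countEvent (M.measurableSet_shieldRegion F) _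

lemma measurable_testFun : Measurable (M.testFun hd F k) := by
  have h1 := measurable_ind (M.measurableSet_gadgetEvent (k := k) hd)
  have h2 := measurable_ind M.measurableSet_emptyEvent
  have h3 := measurable_ind (M.measurableSet_shieldEvent (k := k) F)
  exact h3.mul ((h1.const_mul _).sub (h2.const_mul _))

lemma volume_ne_top_of_subset {A : Set X} {p : X} {r : ℝ} (h : A ⊆ cball p r) :
    volume A ≠ ⊤ :=
  ne_top_of_le_ne_top (M.volume_cball_ne_top p r) (measure_mono h)

lemma gadgetProb_pos : 0 < M.gadgetProb hd k := by
  refine countProb_pos (fun j => j.elim 0 (gadgetCount hd k)) (fun j => rfl)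
    (fun j => M.volume_ne_top_of_subset (M.gadgetRegion_subset hd j)) fun j => ?_
  rcases j with _ | j
  · exact Or.inl rfl
  · exact Or.inr (M.volume_region_pos hd j)

lemma emptyProb_pos : 0 < M.emptyProb :=
  countProb_pos (fun _ => 0) (fun _ => rfl) (fun _ => M.volume_cball_ne_top _ _)
    fun _ => Or.inl rfl

variable {F} in
lemma shieldProb_pos (hF : ∀ w ∈ F, dist M.origin w = 3) : 0 < M.shieldProb F k := by
  refine countProb_pos (fun j => j.elim 0 fun _ => k + 2) (fun j => ?_)
    (fun j => M.volume_ne_top_of_subset (M.shieldRegion_subset hF j)) fun j => ?_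
  · rcases j with _ | j
    · exact rfl
    · exact (le_rfl : ((k + 2 : ℕ) : ℕ∞) ≤ (k + 2 : ℕ))
  · rcases j with _ | j
    · exact Or.inl rfl
    · exact Or.inr (M.volume_cball_pos _ (by norm_num))

section Probabilities

variable {M F} {Ω : Type*} [MeasurableSpace Ω] {P : Measure Ω} {η : Ω → Set X}

lemma measureReal_gadgetEvent (h : IsPoissonProcess η P volume) :
    P.real {ω | Config.mk (η ω) ∈ M.gadgetEvent hd k} = M.gadgetProb hd k := by
  refine h.measureReal_countEvent M.measurableSet_gadgetRegion ?_
    (fun j => M.volume_ne_top_of_subset (M.gadgetRegion_subset hd j)) _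
  rintro (_ | i) (_ | j) hij
  · exact absurd rfl hij
  · exact Set.disjoint_left.2 fun x hx hx' => hx.2 (Set.mem_iUnion.2 ⟨j, hx'⟩)
  · exact Set.disjoint_left.2 fun x hx' hx => hx.2 (Set.mem_iUnion.2 ⟨i, hx'⟩)
  · exact M.disjoint_region hd fun h => hij (by rw [h])

lemma measureReal_emptyEvent (h : IsPoissonProcess η P volume) :
    P.real {ω | Config.mk (η ω) ∈ M.emptyEvent} = M.emptyProb :=
  h.measureReal_countEvent (fun _ => M.measurableSet_cball _ _)
    (fun _ _ hij => absurd rfl hij) (fun _ => M.volume_cball_ne_top _ _) _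

lemma measureReal_shieldEvent (hF : ∀ w ∈ F, dist M.origin w = 3)
    (hsep : ∀ z ∈ F, ∀ w ∈ F, z ≠ w → 1 < dist z w) (h : IsPoissonProcess η P volume) :
    P.real {ω | Config.mk (η ω) ∈ M.shieldEvent F k} = M.shieldProb F k := by
  refine h.measureReal_countEvent (M.measurableSet_shieldRegion F) ?_
    (fun j => M.volume_ne_top_of_subset (M.shieldRegion_subset hF j)) _
  have hbuf : ∀ w : F, Disjoint (M.buffer F) (cball w.1 (1 / 3)) := fun w =>
    Set.disjoint_left.2 fun x hx hx' => hx.2 (Or.inr (Set.mem_iUnion₂.2 ⟨w.1, w.2, hx'⟩))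
  rintro (_ | i) (_ | j) hij
  · exact absurd rfl hij
  · exact hbuf j
  · exact (hbuf i).symm
  · have := hsep i.1 i.2 j.1 j.2 fun h => hij (by rw [Subtype.ext h])
    exact M.disjoint_cball (by linarith)

lemma indicator_shieldEvent_inter (hF : ∀ w ∈ F, dist M.origin w = 3) (S : Set X) :
    ind (M.shieldEvent F k) ⟨S ∩ (cball M.origin 1)ᶜ⟩
      = ind (M.shieldEvent F k) ⟨S⟩ :=
  ind_congr (inter_mem_countEvent_iff (M.shieldRegion_subset_compl hF)
    (fun j => j.elim {0} fun _ => {n | ((k + 2 : ℕ) : ℕ∞) ≤ n}) ⟨S⟩)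

lemma integral_shieldEvent (hF : ∀ w ∈ F, dist M.origin w = 3)
    (hsep : ∀ z ∈ F, ∀ w ∈ F, z ≠ w → 1 < dist z w) (h : IsPoissonProcess η P volume) :
    ∫ ω, ind (M.shieldEvent F k) ⟨η ω ∩ (cball M.origin 1)ᶜ⟩ ∂P
      = M.shieldProb F k := by
  simp only [indicator_shieldEvent_inter hF]
  rw [h.integral_ind (M.measurableSet_shieldEvent F), measureReal_shieldEvent hF hsep h]

end Probabilities

/-- The test function of the cell depends only on the points in the ball of radius `4`. -/
lemma testFun_inter (hF : ∀ w ∈ F, dist M.origin w = 3) (S : Config X) :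
    M.testFun hd F k ⟨S.points ∩ cball M.origin 4⟩ = M.testFun hd F k S := by
  have h14 : cball M.origin 1 ⊆ cball M.origin 4 :=
    M.cball_subset_cball _ _ (by rw [M.dist_self]; norm_num)
  have h1 := inter_mem_countEvent_iff (M.shieldRegion_subset hF)
    (fun j => j.elim {0} fun _ => {n | ((k + 2 : ℕ) : ℕ∞) ≤ n}) S
  have h2 := inter_mem_countEvent_iff (fun j => (M.gadgetRegion_subset hd j).trans h14)
    (fun j => {((j.elim 0 (gadgetCount hd k) : ℕ) : ℕ∞)}) S
  have h3 := inter_mem_countEvent_iff (A := fun _ : Unit => cball M.origin 1) (fun _ => h14)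
    (fun _ => {0}) S
  simp only [testFun, shieldEvent, gadgetEvent, emptyEvent]
  rw [ind_congr h1, ind_congr h2, ind_congr h3]

lemma abs_testFun_le (hk0 : M.gadgetProb hd k ≤ 1) (he : M.emptyProb ≤ 1) (S : Config X) :
    |M.testFun hd F k S| ≤ 1 := by
  have h1 := M.gadgetProb_pos hd (k := k)
  have h2 := M.emptyProb_pos
  rw [testFun, abs_le]
  rcases ind_eq_zero_or_one (M.shieldEvent F k) S with h3 | h3 <;>
    rcases ind_eq_zero_or_one (M.gadgetEvent hd k) S with h4 | h4 <;>
    rcases ind_eq_zero_or_one M.emptyEvent S with h5 | h5 <;>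
    rw [h3, h4, h5] <;> constructor <;> linarith

section Expectation

variable {M F} {Ω : Type*} [MeasurableSpace Ω] {P : Measure Ω} [IsProbabilityMeasure P]
  {η : Ω → Set X}

lemma gadgetProb_le_one (h : IsPoissonProcess η P volume) : M.gadgetProb hd k ≤ 1 := by
  rw [← measureReal_gadgetEvent hd h]; exact measureReal_le_one

lemma emptyProb_le_one (h : IsPoissonProcess η P volume) : M.emptyProb ≤ 1 := by
  rw [← measureReal_emptyEvent h]; exact measureReal_le_one

/-- The expectation of a product of functions of the points inside and outside of the unit ball,
where the first is the indicator function of a count event. -/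
lemma integral_indicator_mul {E : Set (Config X)} (h : IsPoissonProcess η P volume)
    (hE : MeasurableSet E)
    (hEI : ∀ S : Config X, Config.mk (S.points ∩ cball M.origin 1) ∈ E ↔ S ∈ E)
    {U : Config X → ℝ} (hU : Measurable U) :
    ∫ ω, ind E ⟨η ω⟩ * U ⟨η ω ∩ (cball M.origin 1)ᶜ⟩ ∂P
      = P.real {ω | Config.mk (η ω) ∈ E} * ∫ ω, U ⟨η ω ∩ (cball M.origin 1)ᶜ⟩ ∂P := by
  have hI := M.measurableSet_cball M.origin 1
  have hind := h.indepFun_inter hI hI.compl disjoint_compl_right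
  have hm := measurable_ind hE
  have hcomp := hind.comp hm hU
  have e1 : ∀ ω, ind E ⟨η ω ∩ cball M.origin 1⟩
      = ind E ⟨η ω⟩ := fun ω =>
    ind_congr (hEI ⟨η ω⟩)
  have h2 := hcomp.integral_fun_mul_eq_mul_integral
    (hm.comp ((Config.measurable_inter hI).comp h.measurable)).aestronglyMeasurable
    (hU.comp ((Config.measurable_inter hI.compl).comp h.measurable)).aestronglyMeasurable
  simp only [Function.comp_apply, e1] at h2
  rw [h2, h.integral_ind hE]

lemma inter_cball_mem_gadgetEvent_iff (S : Config X) :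
    Config.mk (S.points ∩ cball M.origin 1) ∈ M.gadgetEvent hd k ↔ S ∈ M.gadgetEvent hd k :=
  inter_mem_countEvent_iff (M.gadgetRegion_subset hd) _ S

lemma inter_cball_mem_emptyEvent_iff (S : Config X) :
    Config.mk (S.points ∩ cball M.origin 1) ∈ M.emptyEvent ↔ S ∈ M.emptyEvent :=
  inter_mem_countEvent_iff (fun _ => le_rfl) _ S

end Expectation

end GeodesicModel

namespace GeodesicModel

variable {d : ℕ} {X : Type*} [Dist X] [MeasureSpace X] {M : GeodesicModel d X}

/-! ### The correlation of the count with the test function -/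

section Expectation

variable {k : ℕ} (hd : 1 ≤ d) {F : Finset X} {Ω : Type*} [MeasurableSpace Ω] {P : Measure Ω}
  [IsProbabilityMeasure P] {η : Ω → Set X}

/-- The test function as a function of the points inside and outside of the unit ball. -/
lemma testFun_eq (hF : ∀ w ∈ F, dist M.origin w = 3) (S : Set X) :
    M.testFun hd F k ⟨S⟩ = M.emptyProb * (ind (M.gadgetEvent hd k) ⟨S⟩ *
        ind (M.shieldEvent F k) ⟨S ∩ (cball M.origin 1)ᶜ⟩)
      - M.gadgetProb hd k * (ind M.emptyEvent ⟨S⟩ *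
        ind (M.shieldEvent F k) ⟨S ∩ (cball M.origin 1)ᶜ⟩) := by
  rw [testFun, indicator_shieldEvent_inter hF]
  ring

omit [IsProbabilityMeasure P] in
lemma integrable_ind_mul {U : Config X → ℝ} {E : Set (Config X)} (hE : MeasurableSet E)
    (h : IsPoissonProcess η P volume)
    (hU : Integrable (fun ω => U ⟨η ω ∩ (cball M.origin 1)ᶜ⟩) P) :
    Integrable (fun ω => ind E ⟨η ω⟩ * U ⟨η ω ∩ (cball M.origin 1)ᶜ⟩) P :=
  hU.bdd_mul ((measurable_ind hE).comp h.measurable).aestronglyMeasurable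
    (Filter.Eventually.of_forall fun ω => abs_ind_le E ⟨η ω⟩)

lemma integrable_ind_compl (h : IsPoissonProcess η P volume) {E : Set (Config X)}
    (hE : MeasurableSet E) :
    Integrable (fun ω => ind E ⟨η ω ∩ (cball M.origin 1)ᶜ⟩) P :=
  (memLp_of_abs_le_one ((measurable_ind hE).comp
    ((Config.measurable_inter (M.measurableSet_cball _ _).compl).comp h.measurable))
      fun ω => abs_ind_le _ _).integrable (by norm_num)

lemma integral_gadgetEvent_mul (h : IsPoissonProcess η P volume) {U : Config X → ℝ}
    (hU : Measurable U) :
    ∫ ω, ind (M.gadgetEvent hd k) ⟨η ω⟩ * U ⟨η ω ∩ (cball M.origin 1)ᶜ⟩ ∂P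
      = M.gadgetProb hd k * ∫ ω, U ⟨η ω ∩ (cball M.origin 1)ᶜ⟩ ∂P := by
  rw [integral_indicator_mul h (M.measurableSet_gadgetEvent hd)
    (inter_cball_mem_gadgetEvent_iff hd) hU, measureReal_gadgetEvent hd h]

lemma integral_emptyEvent_mul (h : IsPoissonProcess η P volume) {U : Config X → ℝ}
    (hU : Measurable U) :
    ∫ ω, ind M.emptyEvent ⟨η ω⟩ * U ⟨η ω ∩ (cball M.origin 1)ᶜ⟩ ∂P
      = M.emptyProb * ∫ ω, U ⟨η ω ∩ (cball M.origin 1)ᶜ⟩ ∂P := by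
  rw [integral_indicator_mul h M.measurableSet_emptyEvent
    inter_cball_mem_emptyEvent_iff hU, measureReal_emptyEvent h]

lemma integral_testFun (hF : ∀ w ∈ F, dist M.origin w = 3) (h : IsPoissonProcess η P volume) :
    ∫ ω, M.testFun hd F k ⟨η ω⟩ ∂P = 0 := by
  have hsh := M.measurableSet_shieldEvent (k := k) F
  simp only [testFun_eq hd hF]
  have hi := integrable_ind_compl (M := M) h hsh
  rw [integral_sub ((integrable_ind_mul (M.measurableSet_gadgetEvent hd) h hi).const_mul _)
    ((integrable_ind_mul M.measurableSet_emptyEvent h hi).const_mul _), integral_const_mul,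
    integral_const_mul, integral_gadgetEvent_mul hd h (measurable_ind hsh),
    integral_emptyEvent_mul h (measurable_ind hsh)]
  ring

/-- The correlation of the number of points of outdegree `k` with the test function of a cell:
given the points outside the unit ball, on the shield event the gadget adds at least one to the
number for the empty unit ball, which is independent of the points in the unit ball. -/
lemma le_integral_outdegCount_mul_testFun [StandardBorelSpace X] (hk : d + 1 ≤ k)
    (hF : ∀ w ∈ F, dist M.origin w = 3) (hsep : ∀ z ∈ F, ∀ w ∈ F, z ≠ w → 1 < dist z w)
    (hnet : ∀ x, dist M.origin x = 3 → ∃ w ∈ F, dist w x ≤ 1)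
    (h : IsPoissonProcess η P volume) {p : X} {t : ℝ} (hp : dist p M.origin ≤ t - 1) :
    M.shieldProb F k * M.emptyProb * M.gadgetProb hd k
      ≤ ∫ ω, outdegCount k p t (η ω) * M.testFun hd F k ⟨η ω⟩ ∂P := by
  obtain ⟨g, hg, hgS⟩ := M.exists_measurable_outdegCount k p t
  have hsh := M.measurableSet_shieldEvent (k := k) F
  have hgad := M.measurableSet_gadgetEvent (k := k) hd
  have hI := M.measurableSet_cball M.origin 1
  have hG := M.memLp_outdegCount h k p t
  have hlf := M.ae_locFinite h
  set W : Config X → ℝ := ind (M.shieldEvent F k) with hW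
  set U : Config X → ℝ := fun S => W S * g S with hU
  have hWm : Measurable W := measurable_ind hsh
  have hUm : Measurable U := hWm.mul hg
  have hWi : Integrable (fun ω => W ⟨η ω ∩ (cball M.origin 1)ᶜ⟩) P := integrable_ind_compl h hsh
  have hUi : Integrable (fun ω => U ⟨η ω ∩ (cball M.origin 1)ᶜ⟩) P := by
    have hN := (h.memLp_encard (M.measurableSet_cball p t)
      (M.volume_cball_ne_top p t)).integrable (by norm_num)
    refine hN.mono (hUm.comp ((Config.measurable_inter hI.compl).comp
      h.measurable)).aestronglyMeasurable ?_
    filter_upwards [hlf] with ω hω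
    have h1 : M.LocFinite (η ω ∩ (cball M.origin 1)ᶜ) := hω.mono Set.inter_subset_left
    have h2 := M.outdegCount_le h1 k p t
    have h3 : 0 ≤ outdegCount k p t (η ω ∩ (cball M.origin 1)ᶜ) := Nat.cast_nonneg _
    rw [Real.norm_of_nonneg (Nat.cast_nonneg _), hU]
    simp only
    rw [hgS _ h1, norm_mul, Real.norm_of_nonneg h3]
    have h4 : ((η ω ∩ (cball M.origin 1)ᶜ ∩ cball p t).encard.toNat : ℝ)
        ≤ ((η ω ∩ cball p t).encard.toNat : ℝ) := by
      refine Nat.cast_le.2 (ENat.toNat_le_toNat ?_ (hω.encard_inter_cball_lt_top p t).ne)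
      exact Set.encard_le_encard (Set.inter_subset_inter_left _ Set.inter_subset_left)
    have h5 : ‖W ⟨η ω ∩ (cball M.origin 1)ᶜ⟩‖ ≤ 1 := abs_ind_le _ _
    nlinarith
  have hUWi : Integrable (fun ω => (U + W) ⟨η ω ∩ (cball M.origin 1)ᶜ⟩) P := hUi.add hWi
  have hi1 := integrable_ind_mul hgad h hUWi
  have hi2 := integrable_ind_mul M.measurableSet_emptyEvent h hUi
  have hval : ∫ ω, (M.emptyProb * (ind (M.gadgetEvent hd k) ⟨η ω⟩ *
          (U + W) ⟨η ω ∩ (cball M.origin 1)ᶜ⟩)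
        - M.gadgetProb hd k * (ind M.emptyEvent ⟨η ω⟩ * U ⟨η ω ∩ (cball M.origin 1)ᶜ⟩)) ∂P
      = M.shieldProb F k * M.emptyProb * M.gadgetProb hd k := by
    rw [integral_sub (hi1.const_mul _) (hi2.const_mul _), integral_const_mul, integral_const_mul,
      integral_gadgetEvent_mul hd h (hUm.add hWm), integral_emptyEvent_mul h hUm]
    simp only [Pi.add_apply]
    rw [integral_add hUi hWi, integral_shieldEvent hF hsep h]
    ring
  rw [← hval]
  have hT : MemLp (fun ω => M.testFun hd F k ⟨η ω⟩) 2 P :=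
    memLp_of_abs_le_one ((M.measurable_testFun hd F).comp h.measurable) fun ω =>
      M.abs_testFun_le hd F (gadgetProb_le_one hd h) (emptyProb_le_one h) _
  refine integral_mono_ae ((hi1.const_mul _).sub (hi2.const_mul _)) (hG.integrable_mul hT) ?_
  filter_upwards [hlf] with ω hω
  have h1 : M.LocFinite (η ω ∩ (cball M.origin 1)ᶜ) := hω.mono Set.inter_subset_left
  have hgp := M.gadgetProb_pos hd (k := k)
  have hep := M.emptyProb_pos
  change _ ≤ outdegCount k p t (η ω) * M.testFun hd F k ⟨η ω⟩
  rw [testFun_eq hd hF]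
  simp only [Pi.add_apply, hU]
  rw [hgS _ h1]
  rcases ind_eq_zero_or_one (M.shieldEvent F k) ⟨η ω ∩ (cball M.origin 1)ᶜ⟩ with hs | hs
  · simp only [hW, hs]; simp
  have hmem : Config.mk (η ω) ∈ M.shieldEvent F k := by
    by_contra hcon
    rw [indicator_shieldEvent_inter hF, ind_of_notMem hcon] at hs
    exact zero_ne_one hs
  simp only [hW, hs, one_mul, mul_one]
  have hA : ind (M.gadgetEvent hd k) ⟨η ω⟩ *
      (outdegCount k p t (η ω ∩ (cball M.origin 1)ᶜ) + 1)
      ≤ ind (M.gadgetEvent hd k) ⟨η ω⟩ * outdegCount k p t (η ω) := by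
    by_cases hg' : Config.mk (η ω) ∈ M.gadgetEvent hd k
    · rw [ind_of_mem hg', one_mul, one_mul]
      exact M.outdegCount_sdiff_add_one_le hd F hk hF hnet (S := ⟨η ω⟩) hω hmem hg' hp
    · rw [ind_of_notMem hg', zero_mul, zero_mul]
  have hB : ind M.emptyEvent ⟨η ω⟩ * outdegCount k p t (η ω ∩ (cball M.origin 1)ᶜ)
      = ind M.emptyEvent ⟨η ω⟩ * outdegCount k p t (η ω) := by
    by_cases he : Config.mk (η ω) ∈ M.emptyEvent
    · have h0 : η ω ∩ cball M.origin 1 = ∅ := Set.encard_eq_zero.1 (he ())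
      have : η ω ∩ (cball M.origin 1)ᶜ = η ω :=
        Set.inter_eq_left.2 fun x hx hx1 => by
          have : x ∈ η ω ∩ cball M.origin 1 := ⟨hx, hx1⟩
          rw [h0] at this
          exact this
      rw [this]
    · rw [ind_of_notMem he, zero_mul, zero_mul]
  have hA' := mul_le_mul_of_nonneg_left hA hep.le
  rw [hB]
  linarith

end Expectation

/-! ### The variance bound -/

lemma exists_dist_eq (M : GeodesicModel d X) (p y : X) {r : ℝ} (hr : 0 ≤ r) (hry : r ≤ dist p y) :
    ∃ w, dist p w = r ∧ dist w y = dist p y - r := by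
  obtain ⟨τ, hτ, -, hp⟩ := M.homogeneous p
  have hpy : dist M.origin (τ y) = dist p y := by rw [← hp, hτ]
  obtain ⟨w, hw1, hw2⟩ := M.exists_on_geodesic (τ y) r hr (by rwa [hpy])
  refine ⟨τ.symm w, ?_, ?_⟩
  · rw [← hτ, hp, τ.apply_symm_apply, hw1]
  · rw [← hτ, τ.apply_symm_apply, hw2, hpy]

/-- A ball of radius `t ≥ 1` contains so many points at pairwise distance more than `8` that the
balls of radius `9` around them cover it, all of them at distance at most `t - 1` from the
centre. -/
lemma exists_cells (M : GeodesicModel d X) (p : X) {t : ℝ} (ht : 1 ≤ t) :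
    ∃ C : Finset X, (∀ z ∈ C, dist p z ≤ t - 1) ∧
      (∀ z ∈ C, ∀ w ∈ C, z ≠ w → 8 < dist z w) ∧
      volume.real (cball p t) ≤ C.card * volume.real (cball M.origin 9) := by
  obtain ⟨C, hC, hsep, hnet⟩ := M.exists_separated_net (K := cball p (t - 1)) (s := 8) le_rfl
    (by norm_num)
  refine ⟨C, fun z hz => hC hz, hsep, ?_⟩
  have hcover : cball p t ⊆ ⋃ z ∈ C, cball z 9 := by
    intro x hx
    have hx' : dist p x ≤ t := hx
    have hu : ∃ u ∈ cball p (t - 1), dist u x ≤ 1 := by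
      by_cases h : dist p x ≤ t - 1
      · exact ⟨x, h, by rw [M.dist_self]; norm_num⟩
      · obtain ⟨u, hu1, hu2⟩ := M.exists_dist_eq p x (r := t - 1) (by linarith) (not_le.1 h).le
        exact ⟨u, hu1.le, by linarith⟩
    obtain ⟨u, hu, hux⟩ := hu
    obtain ⟨z, hz, hzu⟩ := hnet u hu
    refine Set.mem_iUnion₂.2 ⟨z, hz, ?_⟩
    have := M.dist_triangle z u x
    change dist z x ≤ 9
    linarith
  have hle : volume (cball p t) ≤ C.card * volume (cball M.origin 9) := by
    refine (measure_mono hcover).trans ((measure_biUnion_finset_le _ _).trans (le_of_eq ?_))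
    simp only [M.volume_cball_eq, Finset.sum_const, nsmul_eq_mul]
  rw [measureReal_def, measureReal_def]
  have := ENNReal.toReal_mono (ENNReal.mul_ne_top (ENNReal.natCast_ne_top _)
    (M.volume_cball_lt_top 9).ne) hle
  simpa using this

/-- The variance of the number of points of outdegree `k` in a ball is at least of the order of the
volume of the ball. -/
theorem exists_mul_volume_le_variance (M : GeodesicModel d X) [StandardBorelSpace X] (hd : 1 ≤ d)
    {k : ℕ} (hk : d + 1 ≤ k) :
    ∃ c : ℝ, 0 < c ∧ ∀ (Ω : Type*) [MeasurableSpace Ω] (P : Measure Ω) [IsProbabilityMeasure P]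
      (η : Ω → Set X), IsPoissonProcess η P volume → ∀ (p : X) (t : ℝ), 1 ≤ t →
        c * volume.real (cball p t) ≤ variance (fun ω => outdegCount k p t (η ω)) P := by
  obtain ⟨F, hFK, hsep, hnet⟩ := M.exists_separated_net (K := {x | dist M.origin x = 3})
    (p := M.origin) (r := 3) (s := 1) (fun x hx => le_of_eq hx) one_pos
  have hF : ∀ w ∈ F, dist M.origin w = 3 := fun w hw => hFK hw
  set q := M.shieldProb F k * M.emptyProb * M.gadgetProb hd k with hq
  have hq0 : 0 < q :=
    mul_pos (mul_pos (M.shieldProb_pos hF) M.emptyProb_pos) (M.gadgetProb_pos hd)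
  set v := volume.real (cball M.origin 9) with hv
  have hv0 : 0 < v :=
    ENNReal.toReal_pos (M.volume_cball_pos _ (by norm_num)).ne' (M.volume_cball_lt_top 9).ne
  refine ⟨q ^ 2 / v, by positivity, fun Ω _ P _ η h p t ht => ?_⟩
  obtain ⟨C, hCt, hCsep, hCvol⟩ := M.exists_cells p ht
  choose τ hτ hτm hτz using M.homogeneous
  have hη : ∀ z, IsPoissonProcess (fun ω => τ z '' η ω) P volume := fun z =>
    h.image (τ z) (hτm z)
  -- the test function of the cell around `z`
  let f : X → Ω → ℝ := fun z ω => M.testFun hd F k ⟨τ z '' η ω⟩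
  have hfm : ∀ z, Measurable (f z) := fun z =>
    (M.measurable_testFun hd F).comp (hη z).measurable
  have hf1 : ∀ z ω, |f z ω| ≤ 1 := fun z ω =>
    M.abs_testFun_le hd F (gadgetProb_le_one hd h) (emptyProb_le_one h) _
  have hf0 : ∀ z, ∫ ω, f z ω ∂P = 0 := fun z => integral_testFun hd hF (hη z)
  have hloc : ∀ z ω, f z ω = M.testFun hd F k ⟨τ z '' (η ω ∩ cball z 4)⟩ := by
    intro z ω
    have e : τ z '' (η ω ∩ cball z 4) = τ z '' η ω ∩ cball M.origin 4 := by
      have : cball z 4 = τ z ⁻¹' cball M.origin 4 := by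
        ext x
        change dist z x ≤ 4 ↔ dist M.origin (τ z x) ≤ 4
        rw [← hτz z, hτ]
      rw [this, Set.image_inter_preimage]
    rw [e]
    exact (M.testFun_inter hd F hF ⟨τ z '' η ω⟩).symm
  have hind : ∀ z ∈ C, ∀ w ∈ C, z ≠ w → ∫ ω, f z ω * f w ω ∂P = 0 := by
    intro z hz w hw hzw
    have hd' : Disjoint (cball z 4) (cball w 4) := by
      refine M.disjoint_cball ?_
      have := hCsep z hz w hw hzw
      linarith
    have h1 := h.indepFun_inter (M.measurableSet_cball z 4) (M.measurableSet_cball w 4) hd'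
    have hm : ∀ z, Measurable fun S : Config X => M.testFun hd F k ⟨τ z '' S.points⟩ := fun z =>
      (M.measurable_testFun hd F).comp (Config.measurable_image (τ z))
    have h2 : IndepFun (f z) (f w) P := by
      have := h1.comp (hm z) (hm w)
      rw [show f z = _ from funext (hloc z), show f w = _ from funext (hloc w)]
      exact this
    rw [h2.integral_fun_mul_eq_mul_integral (hfm z).aestronglyMeasurable
      (hfm w).aestronglyMeasurable, hf0, zero_mul]
  have hcorr : ∀ z ∈ C, q ≤ ∫ ω, outdegCount k p t (η ω) * f z ω ∂P := by
    intro z hz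
    have h1 := le_integral_outdegCount_mul_testFun hd hk hF hsep hnet (hη z) (p := τ z p) (t := t)
      (by rw [← hτz z, hτ]; exact hCt z hz)
    refine h1.trans (le_of_eq (integral_congr_ae (Filter.Eventually.of_forall fun ω => ?_)))
    simp only [f]
    rw [show outdegCount k (τ z p) t (τ z '' η ω) = outdegCount k p t (η ω) from
      outdegCount_image k p t (η ω) (τ z).toEquiv (hτ z)]
  have hvar := mul_card_le_variance (M.memLp_outdegCount h k p t) C
    (fun z _ => memLp_of_abs_le_one (hfm z) (hf1 z)) (fun z _ => hf0 z) (fun z _ => ?_) hind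
    hq0.le hcorr
  · refine le_trans ?_ hvar
    rw [div_mul_eq_mul_div, div_le_iff₀ hv0, mul_assoc]
    exact mul_le_mul_of_nonneg_left hCvol (by positivity)
  · calc ∫ ω, f z ω * f z ω ∂P ≤ ∫ _ω, (1 : ℝ) ∂P := by
          refine integral_mono ((memLp_of_abs_le_one (hfm z) (hf1 z)).integrable_mul
            (memLp_of_abs_le_one (hfm z) (hf1 z))) (integrable_const _) fun ω => ?_
          have := abs_le.1 (hf1 z ω)
          change f z ω * f z ω ≤ 1
          nlinarith
      _ = 1 := by simp

end GeodesicModel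

end NNE

end

theorem lemma4p3 (d k : ℕ) (hd : 1 ≤ d) (hk : d + 1 ≤ k) :
    -- Euclidean space
    (∃ c : ℝ, 0 < c ∧
      ∀ (Ω : Type*) [MeasurableSpace Ω] (P : Measure Ω) [IsProbabilityMeasure P]
        (η : Ω → Set (EuclideanSpace ℝ (Fin d))),
        NNE.IsPoissonProcess η P volume →
        ∀ t : ℝ, 2 ≤ t →
          MemLp (fun ω => NNE.outdegCount k 0 t (η ω)) 2 P ∧
          c * NNE.rhoEucl d t ≤ variance (fun ω => NNE.outdegCount k 0 t (η ω)) P ∧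
          c * volume.real (NNE.cball (0 : EuclideanSpace ℝ (Fin d)) t)
            ≤ variance (fun ω => NNE.outdegCount k 0 t (η ω)) P) ∧
    -- hyperbolic space
    (∀ γ : ℝ, 0 < γ →
      ∃ c : ℝ, 0 < c ∧
      ∀ (Ω : Type*) [MeasurableSpace Ω] (P : Measure Ω) [IsProbabilityMeasure P]
        (η : Ω → Set (NNE.HypSpace d)),
        NNE.IsPoissonProcess η P volume →
        ∀ (p : NNE.HypSpace d) (t : ℝ), 2 ≤ t →
          MemLp (fun ω => NNE.outdegCount k p t (η ω)) 2 P ∧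
          c * NNE.rhoHyp d γ t ≤ variance (fun ω => NNE.outdegCount k p t (η ω)) P ∧
          c * volume.real (NNE.cball p t)
            ≤ variance (fun ω => NNE.outdegCount k p t (η ω)) P) := by
  refine ⟨?_, fun γ hγ => ?_⟩
  · obtain ⟨c, hc, h⟩ := (NNE.euclideanModel d).exists_mul_volume_le_variance hd hk
    refine ⟨c, hc, fun Ω _ P _ η hη t ht => ?_⟩
    have hvar := h Ω P η hη 0 t (by linarith)
    refine ⟨(NNE.euclideanModel d).memLp_outdegCount hη k 0 t, ?_, hvar⟩
    rw [NNE.rhoEucl_eq hd (by linarith)]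
    exact hvar
  · obtain ⟨c, hc, h⟩ := (NNE.HypSpace.model d).exists_mul_volume_le_variance hd hk
    obtain ⟨C, hC, hρ⟩ := NNE.HypSpace.exists_rhoHyp_le (d := d) hγ
    have hm : 0 < min c (c / C) := by positivity
    refine ⟨min c (c / C), hm, fun Ω _ P _ η hη p t ht => ?_⟩
    have hvar := h Ω P η hη p t (by linarith)
    have hnn : 0 ≤ volume.real (NNE.cball p t) := measureReal_nonneg
    refine ⟨(NNE.HypSpace.model d).memLp_outdegCount hη k p t, ?_, ?_⟩
    · refine le_trans ?_ hvar
      have h1 := hρ t ht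
      have h2 : volume.real (NNE.cball (NNE.HypSpace.model d).origin t)
          = volume.real (NNE.cball p t) := by
        rw [measureReal_def, measureReal_def, (NNE.HypSpace.model d).volume_cball_eq p]
      rw [h2] at h1
      calc min c (c / C) * NNE.rhoHyp d γ t
          ≤ min c (c / C) * (C * volume.real (NNE.cball p t)) :=
            mul_le_mul_of_nonneg_left h1 hm.le
        _ ≤ c / C * (C * volume.real (NNE.cball p t)) :=
            mul_le_mul_of_nonneg_right (min_le_right _ _) (by positivity)
        _ = c * volume.real (NNE.cball p t) := by field_simp
    · exact (mul_le_mul_of_nonneg_right (min_le_left _ _) hnn).trans hvar
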